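/- All $C^*$-correspondences are nondegenerate: an $A$-$B$ correspondence ${}_AM_B$ is a right Hilbert $B$-module $M$ (inner product $\langle\cdot,\cdot\rangle_B$ linear in the second variable) with a homomorphism $\varphi_M\colon A\to\mathcal L(M)$ into the adjointable operators such that $A\cdot M=\{\varphi_M(a)m : a\in A,\ m\in M\}$ is dense in $M$. An isomorphism of $A$-$B$ correspondences is a bijective linear map preserving the left action and the inner product. $M\otimes_B N$ denotes the balanced tensor product, i.e. the Hausdorff completion of the algebraic tensor product $M\odot N$ for $\langle m\otimes n,m'\otimes n'\rangle=\langle n,\langle m,m'\rangle_B\cdot n'\rangle$, with left action $a\mapsto\varphi_M(a)\otimes 1$. $M$ is regular if $\varphi_M$ is injective and $\varphi_M(A)\subset\mathcal K(M)$, where $\mathcal K(M)$ is the closed linear span of the operators $\theta_{x,y}\colon z\mapsto x\langle y,z\rangle_B$. For a correspondence ${}_AX_A$ put $J_X=\{a\in A:\varphi_X(a)\in\mathcal K(X)\text{ and }ab=0\text{ for all }b\in\ker\varphi_X\}$. For ${}_AX_A$ and ${}_BY_B$ consider pairs $({}_AM_B,U_M)$ of an $A$-$B$ correspondence and an isomorphism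 $U_M\colon X\otimes_AM\to M\otimes_BY$ of $A$-$B$ correspondences. Two pairs $(M,U_M)$, $(N,U_N)$ are isomorphic if there is an isomorphism $\xi\colon M\to N$ of $A$-$B$ correspondences with $U_N(1_X\otimes\xi)=(\xi\otimes1_Y)U_M$; write $[M,U_M]$ for the isomorphism class. Theorem. There is a category $\mathsf{ECCor}$ such that (1) the objects are the $C^*$-correspondences ${}_AX_A$ (over arbitrary $C^*$-algebras $A$); (2) the morphisms ${}_AX_A\to{}_BY_B$ are the isomorphism classes $[M,U_M]$ of pairs with $M$ regular and $J_X\cdot M\subset M\cdot J_Y$, where $J_X\cdot M=\{\varphi_M(a)m : a\in J_X,\ m\in M\}$ and $M\cdot J_Y=\{mb : m\in M,\ b\in J_Y\}$; (3) the composition of $[M,U_M]\colon{}_AX_A\to{}_BY_B$ and $[N,U_N]\colon{}_BY_B\to{}_CZ_C$ is $[N,U_N]\circ[M,U_M]=[M\otimes_BN,\,U_{M\otimes_BN}]$, where $U_{M\otimes_BN}=(1_M\otimes U_N)(U_M\otimes1_N)$ (up to the canonical associativity isomorphisms of the tensor product); (4) the identity morphism of ${}_AX_A$ is $[A,U_A]$,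 where ${}_AA_A$ has $\langle a,b\rangle=a^*b$ and left and right multiplication, and $U_A=\iota_l^{-1}\iota_r\colon X\otimes_AA\to A\otimes_AX$ with $\iota_r(x\otimes a)=x\cdot a$ and $\iota_l(a\otimes x)=a\cdot x$. In particular the composition is well defined on isomorphism classes, and the pairs in (3) and (4) satisfy the conditions in (2). -/

import Mathlib

universe u

noncomputable section

open scoped TensorProduct
open UniformSpace

/-- A right Hilbert `B`-module: a complex Banach space with a right action `rsmul x b = x · b`
of the C⋆-algebra `B` and a `B`-valued inner product, conjugate linear in the first and linear in
the second variable, whose norm is `‖x‖ = ‖⟨x, x⟩‖ ^ (1/2)` (so that `⟨x, x⟩ = 0` only for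
`x = 0`). An element of `B` is positive if it has the form `b⋆ b`. -/
structure HilbertModule (B : Type u) [NonUnitalCStarAlgebra B] where
  carrier : Type u
  [normedAddCommGroup : NormedAddCommGroup carrier]
  [normedSpace : NormedSpace ℂ carrier]
  [completeSpace : CompleteSpace carrier]
  rsmul : carrier →ₗ[ℂ] B →ₗ[ℂ] carrier
  rsmul_mul : ∀ x b c, rsmul x (b * c) = rsmul (rsmul x b) c
  inner : carrier →ₗ⋆[ℂ] carrier →ₗ[ℂ] B
  inner_rsmul : ∀ x y b, inner x (rsmul y b) = inner x y * b
  star_inner : ∀ x y, star (inner x y) = inner y x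
  inner_self_nonneg : ∀ x, ∃ b : B, inner x x = star b * b
  norm_sq_eq : ∀ x, ‖x‖ ^ 2 = ‖inner x x‖

attribute [instance] HilbertModule.normedAddCommGroup HilbertModule.normedSpace
  HilbertModule.completeSpace

/-- A right `B`-module with a `B`-valued semi-inner product (no completeness and no
definiteness). -/
structure PreHilbertModule (B : Type u) [NonUnitalCStarAlgebra B] where
  carrier : Type u
  [addCommGroup : AddCommGroup carrier]
  [module : Module ℂ carrier]
  rsmul : carrier →ₗ[ℂ] B →ₗ[ℂ] carrier
  rsmul_mul : ∀ x b c, rsmul x (b * c) = rsmul (rsmul x b) c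
  inner : carrier →ₗ⋆[ℂ] carrier →ₗ[ℂ] B
  inner_rsmul : ∀ x y b, inner x (rsmul y b) = inner x y * b
  star_inner : ∀ x y, star (inner x y) = inner y x
  inner_self_nonneg : ∀ x, ∃ b : B, inner x x = star b * b

namespace PreHilbertModule

attribute [instance] PreHilbertModule.addCommGroup PreHilbertModule.module

variable {B : Type u} [NonUnitalCStarAlgebra B] (P : PreHilbertModule B)

attribute [local instance] CStarAlgebra.spectralOrder CStarAlgebra.spectralOrderedRing

theorem rsmul_inner (x y : P.carrier) (b : B) :
    P.inner (P.rsmul x b) y = star b * P.inner x y := by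
  rw [← P.star_inner, P.inner_rsmul, star_mul, P.star_inner]

/-- The Cauchy-Schwarz inequality for a semi-inner product. -/
theorem norm_inner_sq_le (x y : P.carrier) :
    ‖P.inner x y‖ ^ 2 ≤ ‖P.inner x x‖ * ‖P.inner y y‖ := by
  have nn : ∀ z, 0 ≤ P.inner z z := fun z => by
    obtain ⟨b, hb⟩ := P.inner_self_nonneg z
    rw [hb]; exact star_mul_self_nonneg b
  have key : ∀ k : ℝ, 0 < k → ‖P.inner x x‖ ≤ k →
      ‖P.inner x y‖ ^ 2 ≤ k * ‖P.inner y y‖ := by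
    intro k hk hxk
    set b := P.inner x y with hb
    have hsb : P.inner y x = star b := (P.star_inner x y).symm
    have h0 := nn (P.rsmul x b - (k : ℂ) • y)
    have e : P.inner (P.rsmul x b - (k : ℂ) • y) (P.rsmul x b - (k : ℂ) • y) =
        star b * P.inner x x * b - k • (star b * b) - k • (star b * b)
          + (k * k) • P.inner y y := by
      simp only [map_sub, LinearMap.sub_apply, P.rsmul_inner, P.inner_rsmul, map_smul,
        LinearMap.map_smulₛₗ, LinearMap.smul_apply, hsb, ← hb, mul_assoc]
      simp only [Complex.conj_ofReal, Complex.coe_smul, mul_smul, smul_sub]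
      abel
    rw [e] at h0
    have h1 : star b * P.inner x x * b ≤ k • (star b * b) := by
      have hsa : IsSelfAdjoint (P.inner x x) := P.star_inner x x
      refine (CStarAlgebra.star_left_conjugate_le_norm_smul (a := b) (b := P.inner x x)).trans ?_
      exact smul_le_smul_of_nonneg_right hxk (star_mul_self_nonneg b)
    have h2 : k • (star b * b) ≤ (k * k) • P.inner y y := by
      have h3 := add_nonneg h0 (sub_nonneg.mpr h1)
      rw [← sub_nonneg]
      convert h3 using 1
      abel
    have h4 := CStarAlgebra.norm_le_norm_of_nonneg_of_le
      (smul_nonneg hk.le (star_mul_self_nonneg b)) h2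
    rw [norm_smul, norm_smul, CStarRing.norm_star_mul_self, Real.norm_of_nonneg hk.le,
      Real.norm_of_nonneg (mul_pos hk hk).le, mul_assoc] at h4
    rw [sq]
    exact le_of_mul_le_mul_left h4 hk
  have hlim : ∀ ε : ℝ, 0 < ε →
      ‖P.inner x y‖ ^ 2 ≤ ‖P.inner x x‖ * ‖P.inner y y‖ + ε * ‖P.inner y y‖ := by
    intro ε hε
    have := key (‖P.inner x x‖ + ε) (by positivity) (by linarith)
    linarith
  refine le_of_forall_pos_le_add fun δ hδ => ?_
  have h := hlim (δ / (‖P.inner y y‖ + 1)) (by positivity)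
  refine h.trans ?_
  gcongr
  rw [div_mul_eq_mul_div, div_le_iff₀ (by positivity)]
  nlinarith [norm_nonneg (P.inner y y)]

instance : Norm P.carrier := ⟨fun x => √‖P.inner x x‖⟩

theorem norm_def (x : P.carrier) : ‖x‖ = √‖P.inner x x‖ := rfl

theorem norm_sq_eq (x : P.carrier) : ‖x‖ ^ 2 = ‖P.inner x x‖ := Real.sq_sqrt (norm_nonneg _)

theorem norm_inner_le (x y : P.carrier) : ‖P.inner x y‖ ≤ ‖x‖ * ‖y‖ := by
  rw [norm_def, norm_def, ← Real.sqrt_mul (norm_nonneg _)]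
  exact Real.le_sqrt_of_sq_le (P.norm_inner_sq_le x y)

theorem seminormedSpaceCore : SeminormedSpace.Core ℂ P.carrier where
  norm_nonneg _ := Real.sqrt_nonneg _
  norm_smul c x := by
    simp only [norm_def, map_smul, LinearMap.map_smulₛₗ, LinearMap.smul_apply, norm_smul,
      RCLike.norm_conj]
    rw [← mul_assoc, Real.sqrt_mul (by positivity), Real.sqrt_mul_self (norm_nonneg _)]
  norm_triangle x y := by
    have hx : 0 ≤ ‖x‖ := Real.sqrt_nonneg _
    have hy : 0 ≤ ‖y‖ := Real.sqrt_nonneg _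
    refine le_of_sq_le_sq ?_ (by positivity)
    have e : P.inner (x + y) (x + y) =
        P.inner x x + P.inner x y + P.inner y x + P.inner y y := by
      simp only [map_add, LinearMap.add_apply]
      abel
    rw [P.norm_sq_eq, e]
    have h1 := P.norm_inner_le x y
    have h2 := P.norm_inner_le y x
    have h3 := P.norm_sq_eq x
    have h4 := P.norm_sq_eq y
    have h5 : ‖P.inner x x + P.inner x y + P.inner y x + P.inner y y‖ ≤ _ := norm_add₄_le
    nlinarith

instance : SeminormedAddCommGroup P.carrier := SeminormedAddCommGroup.ofCore P.seminormedSpaceCore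

instance : NormedSpace ℂ P.carrier where
  norm_smul_le c x := (P.seminormedSpaceCore.norm_smul c x).le

end PreHilbertModule

namespace PreHilbertModule

variable {B : Type u} [NonUnitalCStarAlgebra B] (P : PreHilbertModule B)

/-- Right multiplication by `b` as a bounded operator. -/
def rsmulL (b : B) : P.carrier →L[ℂ] P.carrier :=
  (P.rsmul.flip b).mkContinuous ‖b‖ fun x => by
    refine le_of_sq_le_sq ?_ (by positivity)
    rw [mul_pow, P.norm_sq_eq, P.norm_sq_eq, LinearMap.flip_apply, P.rsmul_inner, P.inner_rsmul]
    refine (norm_mul_le _ _).trans ?_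
    rw [norm_star]
    have := norm_mul_le (P.inner x x) b
    nlinarith [norm_nonneg b]

@[simp] theorem rsmulL_apply (b : B) (x : P.carrier) : P.rsmulL b x = P.rsmul x b := rfl

/-- The inner product as a bounded sesquilinear map. -/
def innerL : P.carrier →L⋆[ℂ] P.carrier →L[ℂ] B :=
  P.inner.mkContinuous₂ 1 fun x y => by rw [one_mul]; exact P.norm_inner_le x y

/-- The extension of the inner product to the completion by continuity. -/
def innerC (x y : Completion P.carrier) : B :=
  ((Completion.isDenseInducing_coe.prodMap Completion.isDenseInducing_coe).extend
    (fun p : P.carrier × P.carrier => P.inner p.1 p.2)) (x, y)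

theorem continuous_inner : Continuous fun p : P.carrier × P.carrier => P.inner p.1 p.2 := by
  change Continuous fun p : P.carrier × P.carrier => P.innerL p.1 p.2
  fun_prop

@[simp] theorem innerC_coe (x y : P.carrier) :
    P.innerC (x : Completion P.carrier) (y : Completion P.carrier) = P.inner x y :=
  (Completion.isDenseInducing_coe.prodMap Completion.isDenseInducing_coe).extend_eq
    P.continuous_inner (x, y)

theorem continuous_innerC :
    Continuous fun p : Completion P.carrier × Completion P.carrier => P.innerC p.1 p.2 := by
  let f : P.carrier →+ P.carrier →+ B :=
    { toFun := fun x => (P.inner x).toAddMonoidHom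
      map_zero' := by ext; simp
      map_add' := fun x y => by ext; simp }
  have hf : Continuous fun p : P.carrier × P.carrier => f p.1 p.2 := P.continuous_inner
  exact (Completion.isDenseInducing_toCompl P.carrier).extend_Z_bilin
    (Completion.isDenseInducing_toCompl P.carrier) hf

@[fun_prop]
theorem _root_.Continuous.innerC {T : Type*} [TopologicalSpace T] {f g : T → Completion P.carrier}
    (hf : Continuous f) (hg : Continuous g) : Continuous fun t => P.innerC (f t) (g t) :=
  P.continuous_innerC.comp (hf.prodMk hg)

theorem continuous_smulC (c : ℂ) : Continuous fun x : Completion P.carrier => c • x :=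
  continuous_const_smul c

theorem innerC_smul_left (c : ℂ) (x y : Completion P.carrier) :
    P.innerC (c • x) y = (starRingEnd ℂ) c • P.innerC x y := by
  refine Completion.induction_on₂ x y ?_ fun x y => ?_
  · have h := P.continuous_innerC.comp
      (((P.continuous_smulC c).comp continuous_fst).prodMk continuous_snd)
    exact isClosed_eq h (P.continuous_innerC.const_smul _)
  · rw [← Completion.coe_smul, innerC_coe, innerC_coe, LinearMap.map_smulₛₗ,
      LinearMap.smul_apply]

theorem innerC_smul_right (c : ℂ) (x y : Completion P.carrier) :
    P.innerC x (c • y) = c • P.innerC x y := by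
  refine Completion.induction_on₂ x y ?_ fun x y => ?_
  · have h := P.continuous_innerC.comp
      (continuous_fst.prodMk ((P.continuous_smulC c).comp continuous_snd))
    exact isClosed_eq h (P.continuous_innerC.const_smul _)
  · rw [← Completion.coe_smul, innerC_coe, innerC_coe, map_smul]

theorem innerC_add_left (x y z : Completion P.carrier) :
    P.innerC (x + y) z = P.innerC x z + P.innerC y z := by
  refine Completion.induction_on₃ x y z ?_ fun x y z => ?_
  · exact isClosed_eq (by fun_prop) (by fun_prop)
  · simp [← Completion.coe_add]

theorem innerC_add_right (x y z : Completion P.carrier) :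
    P.innerC x (y + z) = P.innerC x y + P.innerC x z := by
  refine Completion.induction_on₃ x y z ?_ fun x y z => ?_
  · exact isClosed_eq (by fun_prop) (by fun_prop)
  · simp [← Completion.coe_add]

/-- The extension of the inner product to the completion, as a sesquilinear map. -/
def innerS : Completion P.carrier →ₗ⋆[ℂ] Completion P.carrier →ₗ[ℂ] B :=
  LinearMap.mk₂'ₛₗ (starRingEnd ℂ) (RingHom.id ℂ) P.innerC P.innerC_add_left P.innerC_smul_left
    P.innerC_add_right P.innerC_smul_right

/-- The extension of right multiplication by `b` to the completion. -/
def rsmulC (b : B) : Completion P.carrier →L[ℂ] Completion P.carrier := (P.rsmulL b).completion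

@[simp] theorem rsmulC_coe (b : B) (x : P.carrier) :
    P.rsmulC b (x : Completion P.carrier) = (P.rsmul x b : P.carrier) :=
  ContinuousLinearMap.completion_apply_coe (P.rsmulL b) x

theorem rsmulC_add (x : Completion P.carrier) (b c : B) :
    P.rsmulC (b + c) x = P.rsmulC b x + P.rsmulC c x := by
  refine Completion.induction_on x ?_ fun x => ?_
  · exact isClosed_eq (by fun_prop) (by fun_prop)
  · simp [← Completion.coe_add]

theorem rsmulC_smul (c : ℂ) (x : Completion P.carrier) (b : B) :
    P.rsmulC (c • b) x = c • P.rsmulC b x := by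
  refine Completion.induction_on x ?_ fun x => ?_
  · have h := (P.continuous_smulC c).comp (P.rsmulC b).continuous
    exact isClosed_eq (P.rsmulC (c • b)).continuous h
  · rw [rsmulC_coe, rsmulC_coe, ← Completion.coe_smul]
    simp

/-- The right action on the completion. -/
def rsmulS : Completion P.carrier →ₗ[ℂ] B →ₗ[ℂ] Completion P.carrier :=
  LinearMap.mk₂ ℂ (fun x b => P.rsmulC b x)
    (fun x y b => map_add (P.rsmulC b) x y)
    (fun c x b => map_smul (P.rsmulC b) c x)
    P.rsmulC_add (fun c x b => P.rsmulC_smul c x b)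

theorem rsmulC_mul (x : Completion P.carrier) (b c : B) :
    P.rsmulC (b * c) x = P.rsmulC c (P.rsmulC b x) := by
  induction x using Completion.induction_on with
  | hp => exact isClosed_eq (by fun_prop) (by fun_prop)
  | ih x => simp [P.rsmul_mul]

theorem innerC_rsmulC (x y : Completion P.carrier) (b : B) :
    P.innerC x (P.rsmulC b y) = P.innerC x y * b := by
  induction x, y using Completion.induction_on₂ with
  | hp => exact isClosed_eq (by fun_prop) (by fun_prop)
  | ih x y => simp [P.inner_rsmul]

theorem star_innerC (x y : Completion P.carrier) : star (P.innerC x y) = P.innerC y x := by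
  induction x, y using Completion.induction_on₂ with
  | hp => exact isClosed_eq (by fun_prop) (by fun_prop)
  | ih x y => simp [P.star_inner]

theorem norm_sq_eq_innerC (x : Completion P.carrier) : ‖x‖ ^ 2 = ‖P.innerC x x‖ := by
  induction x using Completion.induction_on with
  | hp => exact isClosed_eq (by fun_prop) (by fun_prop)
  | ih x => rw [Completion.norm_coe, innerC_coe, P.norm_sq_eq]

section

attribute [local instance] CStarAlgebra.spectralOrder CStarAlgebra.spectralOrderedRing

theorem innerC_self_nonneg (x : Completion P.carrier) :
    ∃ b : B, P.innerC x x = star b * b := by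
  refine CStarAlgebra.nonneg_iff_eq_star_mul_self.mp ?_
  induction x using Completion.induction_on with
  | hp => exact isClosed_le (by fun_prop) (by fun_prop)
  | ih x =>
    obtain ⟨b, hb⟩ := P.inner_self_nonneg x
    rw [innerC_coe, hb]
    exact star_mul_self_nonneg b

end

/-- The Hausdorff completion of a semi-inner product module. -/
def completion : HilbertModule B where
  carrier := Completion P.carrier
  rsmul := P.rsmulS
  rsmul_mul := P.rsmulC_mul
  inner := P.innerS
  inner_rsmul := P.innerC_rsmulC
  star_inner := P.star_innerC
  inner_self_nonneg := P.innerC_self_nonneg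
  norm_sq_eq := P.norm_sq_eq_innerC

/-- The canonical map of a semi-inner product module to its Hausdorff completion. -/
def toCompletion : P.carrier →L[ℂ] P.completion.carrier := Completion.toComplL

theorem denseRange_toCompletion : DenseRange P.toCompletion := Completion.denseRange_coe

theorem inner_toCompletion (x y : P.carrier) :
    P.completion.inner (P.toCompletion x) (P.toCompletion y) = P.inner x y := P.innerC_coe x y

theorem rsmul_toCompletion (x : P.carrier) (b : B) :
    P.completion.rsmul (P.toCompletion x) b = P.toCompletion (P.rsmul x b) :=
  P.rsmulC_coe b x

end PreHilbertModule

/-- An `A`-`B` correspondence: a right Hilbert `B`-module with a left action of `A` by adjointable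
operators (`left a` has the adjoint `left a⋆`), that is, with a homomorphism `A → 𝓛(X)`, which is
nondegenerate: the set `A · X = {a · x}` is dense in `X`. -/
structure CStarCorrespondence (A B : Type u) [NonUnitalCStarAlgebra A]
    [NonUnitalCStarAlgebra B] extends HilbertModule B where
  left : A →ₙₐ[ℂ] (carrier →L[ℂ] carrier)
  inner_left : ∀ a x y, inner (left a x) y = inner x (left (star a) y)
  nondegenerate : Dense {z | ∃ a x, left a x = z}

namespace HilbertModule

variable {B : Type u} [NonUnitalCStarAlgebra B] (X : HilbertModule B)

/-- A Hilbert module as a semi-inner product module. -/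
@[simps]
def toPre : PreHilbertModule B where
  carrier := X.carrier
  rsmul := X.rsmul
  rsmul_mul := X.rsmul_mul
  inner := X.inner
  inner_rsmul := X.inner_rsmul
  star_inner := X.star_inner
  inner_self_nonneg := X.inner_self_nonneg

theorem rsmul_inner (x y : X.carrier) (b : B) :
    X.inner (X.rsmul x b) y = star b * X.inner x y := X.toPre.rsmul_inner x y b

theorem norm_eq (x : X.carrier) : ‖x‖ = √‖X.inner x x‖ := by
  rw [← X.norm_sq_eq, Real.sqrt_sq (norm_nonneg x)]

theorem norm_inner_le (x y : X.carrier) : ‖X.inner x y‖ ≤ ‖x‖ * ‖y‖ := by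
  rw [X.norm_eq, X.norm_eq]
  exact X.toPre.norm_inner_le x y

/-- The inner product as a bounded sesquilinear map. -/
def innerL : X.carrier →L⋆[ℂ] X.carrier →L[ℂ] B :=
  X.inner.mkContinuous₂ 1 fun x y => by rw [one_mul]; exact X.norm_inner_le x y

theorem innerL_apply (x y : X.carrier) : X.innerL x y = X.inner x y := rfl

theorem norm_rsmul_le (x : X.carrier) (b : B) : ‖X.rsmul x b‖ ≤ ‖x‖ * ‖b‖ := by
  refine le_of_sq_le_sq ?_ (by positivity)
  rw [mul_pow, X.norm_sq_eq, X.norm_sq_eq, X.rsmul_inner, X.inner_rsmul]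
  refine (norm_mul_le _ _).trans ?_
  rw [norm_star]
  have := norm_mul_le (X.inner x x) b
  nlinarith [norm_nonneg b]

/-- The right action as a bounded bilinear map. -/
def rsmulL : X.carrier →L[ℂ] B →L[ℂ] X.carrier :=
  X.rsmul.mkContinuous₂ 1 fun x b => by rw [one_mul]; exact X.norm_rsmul_le x b

/-- The rank one operator `θ_{x,y} : z ↦ x · ⟨y, z⟩`. -/
def theta (x y : X.carrier) : X.carrier →L[ℂ] X.carrier := X.rsmulL x ∘L X.innerL y

theorem theta_apply (x y z : X.carrier) : X.theta x y z = X.rsmul x (X.inner y z) := rfl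

/-- The compact operators `𝓚(X)`: the norm closure of the linear span of the operators
`θ_{x,y}`. -/
def compacts : Submodule ℂ (X.carrier →L[ℂ] X.carrier) :=
  (Submodule.span ℂ {T | ∃ x y, T = X.theta x y}).topologicalClosure

theorem ext_inner {x y : X.carrier} (h : ∀ z, X.inner z x = X.inner z y) : x = y := by
  rw [← sub_eq_zero, ← norm_eq_zero, ← sq_eq_zero_iff, X.norm_sq_eq, norm_eq_zero, map_sub, h,
    sub_self]

section

attribute [local instance] CStarAlgebra.spectralOrder CStarAlgebra.spectralOrderedRing

/-- The negative part of a self-adjoint element. -/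
theorem exists_negPart {M : Type*} [NonUnitalCStarAlgebra M] {P : M} (hsa : IsSelfAdjoint P) :
    ∃ N R : M, star N = N ∧ N * P * N = -(N * N * N) ∧ N * N * N = star R * R ∧
      (N = 0 → ∃ Q, P = star Q * Q) := by
  have hNn : 0 ≤ P⁻ := CFC.negPart_nonneg P
  have hNs : star P⁻ = P⁻ := (IsSelfAdjoint.of_nonneg hNn).star_eq
  have hpos : 0 ≤ P⁻ * P⁻ * P⁻ := by
    have := star_left_conjugate_nonneg hNn P⁻
    rwa [hNs] at this
  obtain ⟨R, hR⟩ := CStarAlgebra.nonneg_iff_eq_star_mul_self.mp hpos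
  refine ⟨P⁻, R, hNs, ?_, hR, fun h0 => CStarAlgebra.nonneg_iff_eq_star_mul_self.mp ?_⟩
  · have h1 : P⁻ * P * P⁻ = P⁻ * (P⁺ - P⁻) * P⁻ := by rw [CFC.posPart_sub_negPart P hsa]
    rw [h1, mul_assoc, sub_mul, CFC.posPart_mul_negPart P]
    simp [mul_assoc]
  · rw [← CFC.posPart_sub_negPart P hsa, h0, sub_zero]
    exact CFC.posPart_nonneg P

/-- The matrix `(⟨x i, x j⟩)` is positive: it has the form `Q⋆ Q`. -/
theorem exists_gram {n : ℕ} (x : Fin n → X.carrier) :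
    ∃ Q : Fin n → Fin n → B, ∀ i j, X.inner (x i) (x j) = ∑ k, star (Q k i) * Q k j := by
  let P : CStarMatrix (Fin n) (Fin n) B := CStarMatrix.ofMatrix fun i j => X.inner (x i) (x j)
  have hP : ∀ i j, P i j = X.inner (x i) (x j) := fun _ _ => rfl
  have hsa : IsSelfAdjoint P := by
    ext i j
    rw [CStarMatrix.star_apply, hP, hP, X.star_inner]
  obtain ⟨N, R, hNs, hNP, hR, hP0⟩ := exists_negPart hsa
  suffices h : N = 0 by
    obtain ⟨Q, hQ⟩ := hP0 h
    refine ⟨fun i j => Q i j, fun i j => ?_⟩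
    rw [← hP, hQ, CStarMatrix.mul_apply]
    simp [CStarMatrix.star_apply]
  have hdiag : ∀ k, (N * P * N) k k =
      X.inner (∑ i, X.rsmul (x i) (N i k)) (∑ i, X.rsmul (x i) (N i k)) := by
    intro k
    simp only [CStarMatrix.mul_apply, map_sum, LinearMap.sum_apply, X.rsmul_inner, X.inner_rsmul,
      hP, Finset.sum_mul]
    refine Finset.sum_congr rfl fun j _ => Finset.sum_congr rfl fun i _ => ?_
    have : N k i = star (N i k) := by
      conv_lhs => rw [← hNs]
      exact CStarMatrix.star_apply
    rw [this, mul_assoc]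
  have hR0 : ∀ l k, R l k = 0 := by
    intro l k
    have h1 : (∑ l, star (R l k) * R l k) ≤ 0 := by
      obtain ⟨b, hb⟩ := X.inner_self_nonneg (∑ i, X.rsmul (x i) (N i k))
      have h2 := hdiag k
      rw [hb, hNP, CStarMatrix.neg_apply, hR, CStarMatrix.mul_apply] at h2
      have h3 : (∑ l, star (R l k) * R l k) = -(star b * b) := by
        rw [← h2, neg_neg]
        simp [CStarMatrix.star_apply]
      rw [h3]
      exact neg_nonpos.mpr (star_mul_self_nonneg b)
    have h2 : star (R l k) * R l k ≤ 0 :=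
      (Finset.single_le_sum (f := fun l => star (R l k) * R l k)
        (fun i _ => star_mul_self_nonneg _) (Finset.mem_univ l)).trans h1
    exact CStarRing.star_mul_self_eq_zero_iff _ |>.mp
      (le_antisymm h2 (star_mul_self_nonneg _))
  have hR1 : R = 0 := by
    ext l k
    exact hR0 l k
  have hN3 : N * N * N = 0 := by rw [hR, hR1, mul_zero]
  have hN2 : N * N = 0 := by
    rw [← CStarRing.star_mul_self_eq_zero_iff, star_mul, hNs, ← mul_assoc, hN3, zero_mul]
  rw [← CStarRing.star_mul_self_eq_zero_iff, hNs, hN2]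

end

end HilbertModule

namespace CStarCorrespondence

variable {A B C D : Type u} [NonUnitalCStarAlgebra A] [NonUnitalCStarAlgebra B]
  [NonUnitalCStarAlgebra C] [NonUnitalCStarAlgebra D]

section Tensor

variable (X : CStarCorrespondence A B) (Y : CStarCorrespondence B C)

/-- The bilinear map `(u, v) ↦ ⟨y, ⟨x, u⟩ · v⟩`. -/
def tensorForm (x : X.carrier) (y : Y.carrier) : X.carrier →ₗ[ℂ] Y.carrier →ₗ[ℂ] C :=
  LinearMap.mk₂ ℂ (fun u v => Y.inner y (Y.left (X.inner x u) v))
    (fun u u' v => by simp) (fun c u v => by simp) (fun u v v' => by simp) (fun c u v => by simp)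

/-- The semi-inner product `⟨x ⊗ y, u ⊗ v⟩ = ⟨y, ⟨x, u⟩ · v⟩` on the algebraic tensor
product. -/
def tensorInner : X.carrier ⊗[ℂ] Y.carrier →ₗ⋆[ℂ] X.carrier ⊗[ℂ] Y.carrier →ₗ[ℂ] C :=
  TensorProduct.lift <| LinearMap.mk₂'ₛₗ (starRingEnd ℂ) (starRingEnd ℂ)
    (fun x y => TensorProduct.lift (X.tensorForm Y x y))
    (fun x x' y => by ext u v; simp [tensorForm])
    (fun c x y => by ext u v; simp [tensorForm])
    (fun x y y' => by ext u v; simp [tensorForm])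
    (fun c x y => by ext u v; simp [tensorForm])

@[simp] theorem tensorInner_tmul (x u : X.carrier) (y v : Y.carrier) :
    X.tensorInner Y (x ⊗ₜ y) (u ⊗ₜ v) = Y.inner y (Y.left (X.inner x u) v) := rfl

/-- The right action `(x ⊗ y) · c = x ⊗ (y · c)` on the algebraic tensor product. -/
def tensorRsmul : X.carrier ⊗[ℂ] Y.carrier →ₗ[ℂ] C →ₗ[ℂ] X.carrier ⊗[ℂ] Y.carrier :=
  (LinearMap.lTensorHom X.carrier ∘ₗ Y.rsmul.flip).flip

@[simp] theorem tensorRsmul_tmul (x : X.carrier) (y : Y.carrier) (c : C) :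
    X.tensorRsmul Y (x ⊗ₜ y) c = x ⊗ₜ Y.rsmul y c := rfl

theorem star_tensorInner (s t : X.carrier ⊗[ℂ] Y.carrier) :
    star (X.tensorInner Y s t) = X.tensorInner Y t s := by
  induction s with
  | zero => simp
  | add s s' hs hs' => simp [hs, hs']
  | tmul x y =>
    induction t with
    | zero => simp
    | add t t' ht ht' => simp only [map_add, LinearMap.add_apply, star_add, ht, ht']
    | tmul u v =>
      rw [tensorInner_tmul, tensorInner_tmul, Y.star_inner, Y.inner_left, X.star_inner]

/-- Positivity of the semi-inner product on the algebraic tensor product. -/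
theorem tensorInner_self_nonneg (t : X.carrier ⊗[ℂ] Y.carrier) :
    ∃ c : C, X.tensorInner Y t t = star c * c := by
  let _ := CStarAlgebra.spectralOrder C
  have _ := CStarAlgebra.spectralOrderedRing C
  refine CStarAlgebra.nonneg_iff_eq_star_mul_self.mp ?_
  obtain ⟨n, x, y, rfl⟩ : ∃ (n : ℕ) (x : Fin n → X.carrier) (y : Fin n → Y.carrier),
      t = ∑ i, x i ⊗ₜ[ℂ] y i := by
    obtain ⟨S, hS⟩ := TensorProduct.exists_finset t
    refine ⟨S.card, fun i => (S.equivFin.symm i).1.1, fun i => (S.equivFin.symm i).1.2, ?_⟩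
    rw [hS, ← Finset.sum_coe_sort, ← S.equivFin.symm.sum_comp]
  obtain ⟨Q, hQ⟩ := X.exists_gram x
  have e : X.tensorInner Y (∑ i, x i ⊗ₜ[ℂ] y i) (∑ i, x i ⊗ₜ[ℂ] y i) =
      ∑ k, Y.inner (∑ i, Y.left (Q k i) (y i)) (∑ j, Y.left (Q k j) (y j)) := by
    have term : ∀ i j, Y.inner (y i) (Y.left (X.inner (x i) (x j)) (y j)) =
        ∑ k, Y.inner (Y.left (Q k i) (y i)) (Y.left (Q k j) (y j)) := fun i j => by
      rw [hQ, map_sum, sum_apply, map_sum]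
      refine Finset.sum_congr rfl fun k _ => ?_
      rw [Y.inner_left, map_mul]
      rfl
    simp only [map_sum, LinearMap.sum_apply, tensorInner_tmul, term]
    exact (Finset.sum_congr rfl fun j _ => Finset.sum_comm).trans Finset.sum_comm
  rw [e]
  refine Finset.sum_nonneg fun k _ => ?_
  obtain ⟨b, hb⟩ := Y.inner_self_nonneg (∑ i, Y.left (Q k i) (y i))
  rw [hb]
  exact star_mul_self_nonneg b

/-- The algebraic tensor product `X ⊙ Y` as a semi-inner product module. -/
def preTensor : PreHilbertModule C where
  carrier := X.carrier ⊗[ℂ] Y.carrier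
  rsmul := X.tensorRsmul Y
  rsmul_mul t b c := by
    induction t with
    | zero => simp
    | add s t hs ht => simp [hs, ht]
    | tmul x y => simp [Y.rsmul_mul]
  inner := X.tensorInner Y
  inner_rsmul s t c := by
    induction s with
    | zero => simp
    | add s s' hs hs' => simp [hs, hs', add_mul]
    | tmul x y =>
      induction t with
      | zero => simp
      | add t t' ht ht' => simp only [map_add, LinearMap.add_apply, add_mul, ht, ht']
      | tmul u v =>
        have : Y.left (X.inner x u) (Y.rsmul v c) = Y.rsmul (Y.left (X.inner x u) v) c := by
          refine Y.ext_inner fun z => ?_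
          rw [Y.inner_rsmul, ← star_star (X.inner x u), ← Y.inner_left, ← Y.inner_left,
            Y.inner_rsmul]
        rw [tensorRsmul_tmul, tensorInner_tmul, tensorInner_tmul, this, Y.inner_rsmul]
  star_inner := X.star_tensorInner Y
  inner_self_nonneg := X.tensorInner_self_nonneg Y

/-- The elementary tensors in the algebraic tensor product. -/
def preMk : X.carrier →ₗ[ℂ] Y.carrier →ₗ[ℂ] (X.preTensor Y).carrier :=
  TensorProduct.mk ℂ X.carrier Y.carrier

theorem inner_preMk (x u : X.carrier) (y v : Y.carrier) :
    (X.preTensor Y).inner (X.preMk Y x y) (X.preMk Y u v) =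
      Y.inner y (Y.left (X.inner x u) v) := rfl

theorem rsmul_preMk (x : X.carrier) (y : Y.carrier) (c : C) :
    (X.preTensor Y).rsmul (X.preMk Y x y) c = X.preMk Y x (Y.rsmul y c) := rfl

theorem exists_sum_preMk (t : (X.preTensor Y).carrier) :
    ∃ S : Finset (X.carrier × Y.carrier), t = ∑ p ∈ S, X.preMk Y p.1 p.2 :=
  TensorProduct.exists_finset (R := ℂ) (M := X.carrier) (N := Y.carrier) t

/-- The operators `T ⊗ 1` on the algebraic tensor product. -/
def preTensorMap (T : X.carrier →ₗ[ℂ] X.carrier) :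
    (X.preTensor Y).carrier →ₗ[ℂ] (X.preTensor Y).carrier := T.rTensor Y.carrier

theorem preTensorMap_preMk (T : X.carrier →ₗ[ℂ] X.carrier) (x : X.carrier) (y : Y.carrier) :
    X.preTensorMap Y T (X.preMk Y x y) = X.preMk Y (T x) y := rfl

theorem preTensorMap_inner (S T : X.carrier →ₗ[ℂ] X.carrier)
    (h : ∀ x u, X.inner (S x) u = X.inner x (T u)) (s t : (X.preTensor Y).carrier) :
    (X.preTensor Y).inner (X.preTensorMap Y S s) t =
      (X.preTensor Y).inner s (X.preTensorMap Y T t) := by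
  change X.tensorInner Y (S.rTensor Y.carrier s) t = X.tensorInner Y s (T.rTensor Y.carrier t)
  change X.carrier ⊗[ℂ] Y.carrier at s t
  induction s with
  | zero => simp
  | add s s' hs hs' => simp only [map_add, LinearMap.add_apply, hs, hs']
  | tmul x y =>
    induction t with
    | zero => simp
    | add t t' ht ht' => simp only [map_add, ht, ht']
    | tmul u v => simp [h]

/-- The action of the unitization of `A`. -/
def leftUnitization : Unitization ℂ A →ₐ[ℂ] (X.carrier →L[ℂ] X.carrier) :=
  Unitization.lift X.left

theorem leftUnitization_inner (a : Unitization ℂ A) (x u : X.carrier) :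
    X.inner (X.leftUnitization a x) u = X.inner x (X.leftUnitization (star a) u) := by
  induction a with
  | inl_add_inr r a =>
    simp [leftUnitization, X.inner_left, Algebra.algebraMap_eq_smul_one]

theorem norm_preTensorMap_left_le (a : A) (t : (X.preTensor Y).carrier) :
    ‖X.preTensorMap Y (X.left a).toLinearMap t‖ ≤ ‖a‖ * ‖t‖ := by
  let _ := CStarAlgebra.spectralOrder C
  have _ := CStarAlgebra.spectralOrderedRing C
  set T := fun u : Unitization ℂ A => X.preTensorMap Y (X.leftUnitization u).toLinearMap with hT
  have hadj : ∀ u s t, (X.preTensor Y).inner (T u s) t = (X.preTensor Y).inner s (T (star u) t) :=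
    fun u s t => X.preTensorMap_inner Y _ _ (X.leftUnitization_inner u) s t
  have hmul : ∀ u v t, T (u * v) t = T u (T v t) := fun u v t => by
    simp only [hT, preTensorMap, map_mul]
    exact LinearMap.rTensor_comp_apply _ _ _ _
  have hadd : ∀ u v t, T (u + v) t = T u t + T v t := fun u v t => by
    simp only [hT, preTensorMap, map_add]
    exact LinearMap.congr_fun (LinearMap.rTensor_add Y.carrier
      (X.leftUnitization u).toLinearMap (X.leftUnitization v).toLinearMap) t
  have hone : ∀ (r : ℝ) t, T (algebraMap ℝ _ r) t = (r : ℂ) • t := fun r t => by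
    have h : X.leftUnitization (algebraMap ℝ _ r) = (r : ℂ) • 1 := by
      rw [IsScalarTower.algebraMap_apply ℝ ℂ, AlgHom.commutes, Algebra.algebraMap_eq_smul_one]
      rfl
    simp only [hT, preTensorMap, h]
    refine (LinearMap.congr_fun (LinearMap.rTensor_smul Y.carrier (r : ℂ) LinearMap.id) t).trans ?_
    rw [LinearMap.rTensor_id]
    rfl
  obtain ⟨c, hc⟩ := CStarAlgebra.nonneg_iff_eq_star_mul_self.mp
    (sub_nonneg.mpr (CStarAlgebra.star_mul_le_algebraMap_norm_sq (a := (a : Unitization ℂ A))))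
  have hTa : X.preTensorMap Y (X.left a).toLinearMap t = T (a : Unitization ℂ A) t := by
    simp [hT, leftUnitization]
  have h1 : (‖a‖ ^ 2 : ℝ) • (X.preTensor Y).inner t t =
      (X.preTensor Y).inner (T a t) (T a t) + (X.preTensor Y).inner (T c t) (T c t) := by
    rw [hadj, hadj, ← hmul, ← hmul, ← map_add, ← hadd, ← hc, add_sub_cancel, hone, map_smul,
      Unitization.norm_inr, Complex.coe_smul]
  have nn : ∀ s, 0 ≤ (X.preTensor Y).inner s s := fun s => by
    obtain ⟨b, hb⟩ := (X.preTensor Y).inner_self_nonneg s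
    rw [hb]; exact star_mul_self_nonneg b
  refine le_of_sq_le_sq ?_ (by positivity)
  rw [mul_pow, PreHilbertModule.norm_sq_eq, PreHilbertModule.norm_sq_eq, hTa]
  refine (CStarAlgebra.norm_le_norm_of_nonneg_of_le (nn _)
    ((le_add_of_nonneg_right (nn (T c t))).trans_eq h1.symm)).trans ?_
  rw [norm_smul, Real.norm_of_nonneg (by positivity)]

/-- The operator `φ(a) ⊗ 1` on the algebraic tensor product. -/
def preTensorLeft (a : A) : (X.preTensor Y).carrier →L[ℂ] (X.preTensor Y).carrier :=
  (X.preTensorMap Y (X.left a).toLinearMap).mkContinuous ‖a‖ (X.norm_preTensorMap_left_le Y a)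

end Tensor

end CStarCorrespondence

namespace CStarCorrespondence

variable {A B C D : Type u} [NonUnitalCStarAlgebra A] [NonUnitalCStarAlgebra B]
  [NonUnitalCStarAlgebra C] [NonUnitalCStarAlgebra D]

section TensorProduct

variable (X : CStarCorrespondence A B) (Y : CStarCorrespondence B C)

theorem preTensorLeft_preMk (a : A) (x : X.carrier) (y : Y.carrier) :
    X.preTensorLeft Y a (X.preMk Y x y) = X.preMk Y (X.left a x) y := rfl

theorem preTensorLeft_inner (a : A) (s t : (X.preTensor Y).carrier) :
    (X.preTensor Y).inner (X.preTensorLeft Y a s) t =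
      (X.preTensor Y).inner s (X.preTensorLeft Y (star a) t) :=
  X.preTensorMap_inner Y _ _ (X.inner_left a) s t

/-- The elementary tensors `x ⊗_B y` in the completion. -/
def mkC : X.carrier →ₗ[ℂ] Y.carrier →ₗ[ℂ] (X.preTensor Y).completion.carrier :=
  (X.preMk Y).compr₂ (X.preTensor Y).toCompletion.toLinearMap

theorem mkC_apply (x : X.carrier) (y : Y.carrier) :
    X.mkC Y x y = (X.preTensor Y).toCompletion (X.preMk Y x y) := rfl

theorem denseRange_sum_mkC : Dense
    {z | ∃ S : Finset (X.carrier × Y.carrier), z = ∑ p ∈ S, X.mkC Y p.1 p.2} := by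
  refine (X.preTensor Y).denseRange_toCompletion.mono ?_
  rintro _ ⟨t, rfl⟩
  obtain ⟨S, rfl⟩ := X.exists_sum_preMk Y t
  exact ⟨S, map_sum _ _ _⟩

/-- Two bounded operators on the completion which agree on elementary tensors are equal. -/
theorem completion_ext {E : Type*} [NormedAddCommGroup E] [NormedSpace ℂ E]
    {S T : (X.preTensor Y).completion.carrier →L[ℂ] E}
    (h : ∀ x y, S (X.mkC Y x y) = T (X.mkC Y x y)) : S = T := by
  refine ContinuousLinearMap.coeFn_injective
    (Continuous.ext_on (X.denseRange_sum_mkC Y) S.continuous T.continuous ?_)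
  rintro _ ⟨F, rfl⟩
  rw [map_sum, map_sum]
  exact Finset.sum_congr rfl fun p _ => h p.1 p.2

/-- The operator `φ(a) ⊗ 1` on the completed tensor product. -/
def tensorLeft (a : A) :
    (X.preTensor Y).completion.carrier →L[ℂ] (X.preTensor Y).completion.carrier :=
  (X.preTensorLeft Y a).completion

theorem tensorLeft_toCompletion (a : A) (t : (X.preTensor Y).carrier) :
    X.tensorLeft Y a ((X.preTensor Y).toCompletion t) =
      (X.preTensor Y).toCompletion (X.preTensorLeft Y a t) :=
  ContinuousLinearMap.completion_apply_coe (X.preTensorLeft Y a) t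

theorem norm_tensorLeft_le (a : A) (z : (X.preTensor Y).completion.carrier) :
    ‖X.tensorLeft Y a z‖ ≤ ‖a‖ * ‖z‖ := by
  refine (X.preTensor Y).denseRange_toCompletion.induction_on z ?_ fun t => ?_
  · exact isClosed_le (by fun_prop) (by fun_prop)
  · rw [tensorLeft_toCompletion]
    have h1 : ∀ s : (X.preTensor Y).carrier, ‖(X.preTensor Y).toCompletion s‖ = ‖s‖ :=
      fun s => Completion.norm_coe s
    rw [h1, h1]
    exact X.norm_preTensorMap_left_le Y a t

theorem tensorLeft_mkC (a : A) (x : X.carrier) (y : Y.carrier) :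
    X.tensorLeft Y a (X.mkC Y x y) = X.mkC Y (X.left a x) y := by
  rw [mkC_apply, tensorLeft_toCompletion, preTensorLeft_preMk, mkC_apply]

/-- The left action `a ↦ φ(a) ⊗ 1` on the completed tensor product. -/
def tensorLeftHom : A →ₙₐ[ℂ]
    ((X.preTensor Y).completion.carrier →L[ℂ] (X.preTensor Y).completion.carrier) where
  toFun := X.tensorLeft Y
  map_smul' c a := X.completion_ext Y fun x y => by
    change _ = c • X.tensorLeft Y a _
    simp [tensorLeft_mkC]
  map_zero' := X.completion_ext Y fun x y => by simp [tensorLeft_mkC]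
  map_add' a b := X.completion_ext Y fun x y => by
    change _ = X.tensorLeft Y a _ + X.tensorLeft Y b _
    simp [tensorLeft_mkC]
  map_mul' a b := X.completion_ext Y fun x y => by
    change _ = X.tensorLeft Y a (X.tensorLeft Y b _)
    simp [tensorLeft_mkC]

theorem tensorLeft_inner (a : A) (s t : (X.preTensor Y).completion.carrier) :
    (X.preTensor Y).completion.inner (X.tensorLeft Y a s) t =
      (X.preTensor Y).completion.inner s (X.tensorLeft Y (star a) t) := by
  have hc : Continuous fun p : (X.preTensor Y).completion.carrier ×
      (X.preTensor Y).completion.carrier => (X.preTensor Y).completion.innerL p.1 p.2 := by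
    fun_prop
  refine (X.preTensor Y).denseRange_toCompletion.induction_on₂ (p := fun s t =>
    (X.preTensor Y).completion.innerL (X.tensorLeft Y a s) t =
      (X.preTensor Y).completion.innerL s (X.tensorLeft Y (star a) t)) ?_ (fun s t => ?_) s t
  · exact isClosed_eq (by fun_prop) (by fun_prop)
  · simp only [HilbertModule.innerL_apply, tensorLeft_toCompletion,
      PreHilbertModule.inner_toCompletion]
    exact X.preTensorLeft_inner Y a s t

theorem exists_approximateUnit (A : Type u) [NonUnitalCStarAlgebra A] :
    ∃ l : Filter A, l.NeBot ∧ (∀ᶠ e in l, ‖e‖ ≤ 1) ∧ ∀ a, Filter.Tendsto (· * a) l (nhds a) := by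
  let _ := CStarAlgebra.spectralOrder A
  have _ := CStarAlgebra.spectralOrderedRing A
  have h := CStarAlgebra.increasingApproximateUnit A
  exact ⟨CStarAlgebra.approximateUnit A, h.neBot, h.eventually_norm, h.tendsto_mul_right⟩

theorem left_inner (a : A) (x y : X.carrier) :
    X.inner x (X.left a y) = X.inner (X.left (star a) x) y := by
  rw [X.inner_left, star_star]

theorem norm_left_le (a : A) (x : X.carrier) : ‖X.left a x‖ ≤ ‖a‖ * ‖x‖ := by
  let _ := CStarAlgebra.spectralOrder B
  have _ := CStarAlgebra.spectralOrderedRing B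
  obtain ⟨c, hc⟩ := CStarAlgebra.nonneg_iff_eq_star_mul_self.mp
    (sub_nonneg.mpr (CStarAlgebra.star_mul_le_algebraMap_norm_sq (a := (a : Unitization ℂ A))))
  have hone : ∀ r : ℝ, X.leftUnitization (algebraMap ℝ _ r) = (r : ℂ) • 1 := fun r => by
    rw [IsScalarTower.algebraMap_apply ℝ ℂ, AlgHom.commutes, Algebra.algebraMap_eq_smul_one]
    rfl
  have hTa : X.left a = X.leftUnitization (a : Unitization ℂ A) := by
    simp [leftUnitization]
  have hmul : ∀ u v, X.leftUnitization u (X.leftUnitization v x) = X.leftUnitization (u * v) x :=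
    fun u v => by rw [map_mul]; rfl
  have h1 : (‖a‖ ^ 2 : ℝ) • X.inner x x =
      X.inner (X.left a x) (X.left a x) +
        X.inner (X.leftUnitization c x) (X.leftUnitization c x) := by
    rw [hTa, leftUnitization_inner, leftUnitization_inner, hmul, hmul, ← map_add, ← hc]
    have h2 : X.leftUnitization (star (a : Unitization ℂ A) * a) x +
        X.leftUnitization (algebraMap ℝ (Unitization ℂ A) (‖(a : Unitization ℂ A)‖ ^ 2) -
          star (a : Unitization ℂ A) * a) x =
        X.leftUnitization (algebraMap ℝ (Unitization ℂ A) (‖(a : Unitization ℂ A)‖ ^ 2)) x := by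
      rw [map_sub, sub_apply, add_sub_cancel]
    rw [h2, hone, Unitization.norm_inr]
    change _ = X.inner x (((‖a‖ ^ 2 : ℝ) : ℂ) • x)
    rw [map_smul, Complex.coe_smul]
  have nn : ∀ s, 0 ≤ X.inner s s := fun s => by
    obtain ⟨b, hb⟩ := X.inner_self_nonneg s
    rw [hb]; exact star_mul_self_nonneg b
  refine le_of_sq_le_sq ?_ (by positivity)
  rw [mul_pow, X.norm_sq_eq, X.norm_sq_eq]
  refine (CStarAlgebra.norm_le_norm_of_nonneg_of_le (nn _)
    ((le_add_of_nonneg_right (nn (X.leftUnitization c x))).trans_eq h1.symm)).trans ?_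
  rw [norm_smul, Real.norm_of_nonneg (by positivity)]

theorem tendsto_left {l : Filter A} (hl : ∀ᶠ e in l, ‖e‖ ≤ 1)
    (h : ∀ a, Filter.Tendsto (· * a) l (nhds a)) (x : X.carrier) :
    Filter.Tendsto (fun e => X.left e x) l (nhds x) := by
  have hL : ∀ y : X.carrier, Continuous fun e => X.left e y := fun y => by
    let L : A →ₗ[ℂ] X.carrier :=
      { toFun := fun e => X.left e y
        map_add' := fun a b => by rw [map_add]; rfl
        map_smul' := fun c a => by rw [map_smul]; rfl }
    exact (L.mkContinuous ‖y‖ fun e => (X.norm_left_le e y).trans_eq (mul_comm _ _)).continuous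
  rw [Metric.tendsto_nhds]
  intro ε hε
  obtain ⟨z, ⟨a, y, rfl⟩, hz⟩ := X.nondegenerate.exists_dist_lt x (show 0 < ε / 3 by positivity)
  have h1 : Filter.Tendsto (fun e => X.left e (X.left a y)) l (nhds (X.left a y)) := by
    have := (hL y).continuousAt.tendsto.comp (h a)
    refine this.congr fun e => ?_
    simp
  filter_upwards [hl, Metric.tendsto_nhds.mp h1 (ε / 3) (by positivity)] with e he h2
  have h3 : dist (X.left e x) (X.left e (X.left a y)) ≤ dist x (X.left a y) := by
    rw [dist_eq_norm, dist_eq_norm, ← map_sub]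
    refine (X.norm_left_le _ _).trans ?_
    exact mul_le_of_le_one_left (norm_nonneg _) he
  have h4 := dist_triangle4 (X.left e x) (X.left e (X.left a y)) (X.left a y) x
  rw [dist_comm (X.left a y) x] at h4
  linarith

theorem norm_mkC_le (x : X.carrier) (y : Y.carrier) : ‖X.mkC Y x y‖ ≤ ‖x‖ * ‖y‖ := by
  refine le_of_sq_le_sq ?_ (by positivity)
  rw [HilbertModule.norm_sq_eq, mkC_apply, PreHilbertModule.inner_toCompletion, inner_preMk]
  refine (Y.norm_inner_le _ _).trans ?_
  have h1 := Y.norm_left_le (X.inner x x) y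
  have h2 := X.norm_inner_le x x
  calc _ ≤ ‖y‖ * ((‖x‖ * ‖x‖) * ‖y‖) := by gcongr; exact h1.trans (by gcongr)
    _ = _ := by ring

theorem dense_left : Dense {z | ∃ a t, X.tensorLeft Y a t = z} := by
  obtain ⟨l, hl, hb, h⟩ := exists_approximateUnit A
  refine (dense_closure (s := _)).mp ((X.denseRange_sum_mkC Y).mono ?_)
  rintro _ ⟨S, rfl⟩
  refine mem_closure_of_tendsto (f := fun e => X.tensorLeft Y e (∑ p ∈ S, X.mkC Y p.1 p.2))
    (b := l) ?_ (Filter.Eventually.of_forall fun e => ⟨e, _, rfl⟩)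
  simp only [map_sum, tensorLeft_mkC]
  refine tendsto_finsetSum _ fun p _ => ?_
  have hc : Continuous fun x => X.mkC Y x p.2 :=
    (((X.mkC Y).flip p.2).mkContinuous ‖p.2‖ fun x =>
      (X.norm_mkC_le Y x p.2).trans_eq (mul_comm _ _)).continuous
  exact (hc.tendsto p.1).comp (X.tendsto_left hb h p.1)

/-- The balanced tensor product `X ⊗_B Y`: the Hausdorff completion of `X ⊙ Y`. -/
def tensor : CStarCorrespondence A C where
  toHilbertModule := (X.preTensor Y).completion
  left := X.tensorLeftHom Y
  inner_left := X.tensorLeft_inner Y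
  nondegenerate := X.dense_left Y

/-- The elementary tensor `x ⊗_B y`. -/
def tmul : X.carrier →ₗ[ℂ] Y.carrier →ₗ[ℂ] (X.tensor Y).carrier := X.mkC Y

theorem inner_tmul (x u : X.carrier) (y v : Y.carrier) :
    (X.tensor Y).inner (X.tmul Y x y) (X.tmul Y u v) = Y.inner y (Y.left (X.inner x u) v) :=
  (X.preTensor Y).inner_toCompletion _ _

theorem left_tmul (a : A) (x : X.carrier) (y : Y.carrier) :
    (X.tensor Y).left a (X.tmul Y x y) = X.tmul Y (X.left a x) y := X.tensorLeft_mkC Y a x y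

theorem rsmul_tmul (x : X.carrier) (y : Y.carrier) (c : C) :
    (X.tensor Y).rsmul (X.tmul Y x y) c = X.tmul Y x (Y.rsmul y c) :=
  (X.preTensor Y).rsmul_toCompletion _ _

theorem norm_tmul_le (x : X.carrier) (y : Y.carrier) : ‖X.tmul Y x y‖ ≤ ‖x‖ * ‖y‖ :=
  X.norm_mkC_le Y x y

/-- The map `(x, y) ↦ x ⊗_B y` as a bounded bilinear map. -/
def tmulL : X.carrier →L[ℂ] Y.carrier →L[ℂ] (X.tensor Y).carrier :=
  (X.tmul Y).mkContinuous₂ 1 fun x y => by rw [one_mul]; exact X.norm_tmul_le Y x y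

theorem tmulL_apply (x : X.carrier) (y : Y.carrier) : X.tmulL Y x y = X.tmul Y x y := rfl

theorem topologicalClosure_span_tmul :
    (Submodule.span ℂ (Set.range fun p : X.carrier × Y.carrier =>
      X.tmul Y p.1 p.2)).topologicalClosure = ⊤ := by
  rw [← Submodule.dense_iff_topologicalClosure_eq_top]
  refine (X.denseRange_sum_mkC Y).mono ?_
  rintro _ ⟨S, rfl⟩
  exact (Submodule.span ℂ (Set.range fun p : X.carrier × Y.carrier =>
    X.tmul Y p.1 p.2)).sum_mem fun p _ => Submodule.subset_span ⟨p, rfl⟩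

end TensorProduct

end CStarCorrespondence

/-- An isomorphism of `A`-`B` correspondences: a bijective linear map which preserves the left
action and the inner product. -/
structure CStarCorrespondence.Iso {A B : Type u} [NonUnitalCStarAlgebra A]
    [NonUnitalCStarAlgebra B] (M N : CStarCorrespondence A B) where
  toEquiv : M.carrier ≃ₗ[ℂ] N.carrier
  map_left : ∀ a m, toEquiv (M.left a m) = N.left a (toEquiv m)
  inner_map : ∀ m m', N.inner (toEquiv m) (toEquiv m') = M.inner m m'

namespace CStarCorrespondence

variable {A B C D : Type u} [NonUnitalCStarAlgebra A] [NonUnitalCStarAlgebra B]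
  [NonUnitalCStarAlgebra C] [NonUnitalCStarAlgebra D]

namespace Iso

variable {M N K : CStarCorrespondence A B}

instance : CoeFun (Iso M N) fun _ => M.carrier → N.carrier := ⟨fun e => e.toEquiv⟩

/-- The identity. -/
def refl (M : CStarCorrespondence A B) : Iso M M where
  toEquiv := LinearEquiv.refl ℂ _
  map_left _ _ := rfl
  inner_map _ _ := rfl

/-- The inverse isomorphism. -/
def symm (e : Iso M N) : Iso N M where
  toEquiv := e.toEquiv.symm
  map_left a n := by
    rw [LinearEquiv.symm_apply_eq, e.map_left, LinearEquiv.apply_symm_apply]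
  inner_map n n' := by
    rw [← e.inner_map, LinearEquiv.apply_symm_apply, LinearEquiv.apply_symm_apply]

/-- The composition `m ↦ f (e m)`. -/
def trans (e : Iso M N) (f : Iso N K) : Iso M K where
  toEquiv := e.toEquiv.trans f.toEquiv
  map_left a m := by simp [e.map_left, f.map_left]
  inner_map m m' := by simp [e.inner_map, f.inner_map]

theorem trans_apply (e : Iso M N) (f : Iso N K) (m : M.carrier) : e.trans f m = f (e m) := rfl

theorem symm_apply_apply (e : Iso M N) (m : M.carrier) : e.symm (e m) = m :=
  e.toEquiv.symm_apply_apply m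

theorem apply_symm_apply (e : Iso M N) (n : N.carrier) : e (e.symm n) = n :=
  e.toEquiv.apply_symm_apply n

theorem norm_map (e : Iso M N) (m : M.carrier) : ‖e m‖ = ‖m‖ := by
  rw [N.norm_eq, M.norm_eq, e.inner_map]

theorem continuous (e : Iso M N) : Continuous e :=
  (LinearIsometryEquiv.mk e.toEquiv e.norm_map).continuous

theorem ext_of_dense {I : Type*} {f : I → M.carrier}
    (hf : (Submodule.span ℂ (Set.range f)).topologicalClosure = ⊤) {e e' : Iso M N}
    (h : ∀ i, e (f i) = e' (f i)) (m : M.carrier) : e m = e' m := by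
  rw [← Submodule.dense_iff_topologicalClosure_eq_top] at hf
  refine congrFun (Continuous.ext_on hf e.continuous e'.continuous ?_) m
  have : Set.EqOn e.toEquiv.toLinearMap e'.toEquiv.toLinearMap (Submodule.span ℂ (Set.range f)) :=
    LinearMap.eqOn_span (by rintro _ ⟨i, rfl⟩; exact h i)
  exact this

/-- Two families of vectors with dense linear span and the same inner products are identified by
an isomorphism, if the left action permutes them in the same way. -/
theorem exists_of_generators {I : Type*} (f : I → M.carrier) (g : I → N.carrier)
    (hf : (Submodule.span ℂ (Set.range f)).topologicalClosure = ⊤)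
    (hg : (Submodule.span ℂ (Set.range g)).topologicalClosure = ⊤)
    (hinner : ∀ i j, N.inner (g i) (g j) = M.inner (f i) (f j))
    (hleft : ∀ a i, ∃ j, M.left a (f i) = f j ∧ N.left a (g i) = g j) :
    ∃ e : Iso M N, ∀ i, e (f i) = g i := by
  rw [← Submodule.dense_iff_topologicalClosure_eq_top] at hf hg
  let F := Finsupp.linearCombination ℂ f
  let G := Finsupp.linearCombination ℂ g
  have hF : DenseRange F := by
    rw [← Finsupp.range_linearCombination] at hf; exact hf
  have hG : DenseRange G := by
    rw [← Finsupp.range_linearCombination] at hg; exact hg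
  have hFG : ∀ s t, N.inner (G s) (G t) = M.inner (F s) (F t) := by
    intro s t
    simp only [F, G, Finsupp.linearCombination_apply, Finsupp.sum, map_sum, LinearMap.sum_apply,
      map_smul, LinearMap.map_smulₛₗ, LinearMap.smul_apply, hinner]
  have hn : ∀ s, ‖G s‖ = ‖F s‖ := fun s => by rw [N.norm_eq, M.norm_eq, hFG]
  let e := (LinearEquiv.refl ℂ (I →₀ ℂ)).extendOfIsometry F G hF hG hn
  have he : ∀ s, e (F s) = G s := fun s =>
    LinearEquiv.extend_eq (LinearEquiv.refl ℂ (I →₀ ℂ)) F G hF ⟨1, by simp [hn]⟩ hG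
      ⟨1, by simp [hn]⟩ s
  have hei : ∀ i, e (f i) = g i := fun i => by
    have := he (Finsupp.single i 1)
    simpa [F, G] using this
  refine ⟨⟨e.toLinearEquiv, fun a m => ?_, fun m m' => ?_⟩, hei⟩
  · change e (M.left a m) = N.left a (e m)
    have h1 : Continuous fun m => e (M.left a m) := e.continuous.comp (M.left a).continuous
    have h2 : Continuous fun m => N.left a (e m) := (N.left a).continuous.comp e.continuous
    refine hF.induction_on (p := fun m => e (M.left a m) = N.left a (e m)) m
      (isClosed_eq h1 h2) fun s => ?_
    simp only [F, Finsupp.linearCombination_apply, Finsupp.sum, map_sum, map_smul, hei]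
    refine Finset.sum_congr rfl fun i _ => ?_
    obtain ⟨j, hj, hj'⟩ := hleft a i
    rw [hj, hj', hei]
  · change N.inner (e m) (e m') = M.inner m m'
    have h1 : Continuous fun p : M.carrier × M.carrier => N.innerL (e p.1) (e p.2) := by fun_prop
    have h2 : Continuous fun p : M.carrier × M.carrier => M.innerL p.1 p.2 := by fun_prop
    refine hF.induction_on₂ (p := fun m m' => N.inner (e m) (e m') = M.inner m m')
      (isClosed_eq h1 h2) (fun s t => ?_) m m'
    rw [he, he, hFG]

/-- The isomorphism of `exists_of_generators`. -/
def ofGenerators {I : Type*} (f : I → M.carrier) (g : I → N.carrier)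
    (hf : (Submodule.span ℂ (Set.range f)).topologicalClosure = ⊤)
    (hg : (Submodule.span ℂ (Set.range g)).topologicalClosure = ⊤)
    (hinner : ∀ i j, N.inner (g i) (g j) = M.inner (f i) (f j))
    (hleft : ∀ a i, ∃ j, M.left a (f i) = f j ∧ N.left a (g i) = g j) : Iso M N :=
  (exists_of_generators f g hf hg hinner hleft).choose

theorem ofGenerators_apply {I : Type*} (f : I → M.carrier) (g : I → N.carrier) (hf) (hg)
    (hinner) (hleft) (i : I) : ofGenerators (M := M) (N := N) f g hf hg hinner hleft (f i) = g i :=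
  (exists_of_generators f g hf hg hinner hleft).choose_spec i

end Iso

/-- The isomorphism `ξ ⊗ η : M ⊗_B N → M' ⊗_B N'`, `m ⊗ n ↦ ξ m ⊗ η n`. -/
def Iso.tensor {M M' : CStarCorrespondence A B} {N N' : CStarCorrespondence B C}
    (ξ : Iso M M') (η : Iso N N') : Iso (M.tensor N) (M'.tensor N') :=
  Iso.ofGenerators (fun p : M.carrier × N.carrier => M.tmul N p.1 p.2)
    (fun p => M'.tmul N' (ξ p.1) (η p.2)) (M.topologicalClosure_span_tmul N)
    (by
      rw [← M'.topologicalClosure_span_tmul N']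
      congr 2
      ext z
      constructor
      · rintro ⟨p, rfl⟩
        exact ⟨(ξ p.1, η p.2), rfl⟩
      · rintro ⟨p, rfl⟩
        exact ⟨(ξ.symm p.1, η.symm p.2), by simp [Iso.apply_symm_apply]⟩)
    (fun p q => by
      rw [inner_tmul, inner_tmul, ξ.inner_map, ← η.map_left, η.inner_map])
    (fun a p => ⟨(M.left a p.1, p.2), by rw [left_tmul], by rw [left_tmul, ξ.map_left]⟩)

theorem Iso.tensor_tmul {M M' : CStarCorrespondence A B} {N N' : CStarCorrespondence B C}
    (ξ : Iso M M') (η : Iso N N') (m : M.carrier) (n : N.carrier) :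
    ξ.tensor η (M.tmul N m n) = M'.tmul N' (ξ m) (η n) :=
  Iso.ofGenerators_apply (fun p : M.carrier × N.carrier => M.tmul N p.1 p.2) _ _ _ _ _ (m, n)

theorem topologicalClosure_span_tmul_tmul (M : CStarCorrespondence A B)
    (N : CStarCorrespondence B C) (K : CStarCorrespondence C D) :
    (Submodule.span ℂ (Set.range fun p : M.carrier × N.carrier × K.carrier =>
      (M.tensor N).tmul K (M.tmul N p.1 p.2.1) p.2.2)).topologicalClosure = ⊤ := by
  set S := (Submodule.span ℂ (Set.range fun p : M.carrier × N.carrier × K.carrier =>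
      (M.tensor N).tmul K (M.tmul N p.1 p.2.1) p.2.2)).topologicalClosure with hS
  have hcl : IsClosed (S : Set ((M.tensor N).tensor K).carrier) :=
    Submodule.isClosed_topologicalClosure _
  rw [eq_top_iff, ← (M.tensor N).topologicalClosure_span_tmul K]
  refine Submodule.topologicalClosure_minimal _ (Submodule.span_le.mpr ?_) hcl
  rintro _ ⟨⟨t, k⟩, rfl⟩
  have h1 : (⊤ : Submodule ℂ (M.tensor N).carrier) ≤
      S.comap (((M.tensor N).tmulL K).flip k).toLinearMap := by
    rw [← M.topologicalClosure_span_tmul N]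
    refine Submodule.topologicalClosure_minimal _ (Submodule.span_le.mpr ?_)
      (hcl.preimage (((M.tensor N).tmulL K).flip k).continuous)
    rintro _ ⟨⟨m, n⟩, rfl⟩
    exact Submodule.le_topologicalClosure _ (Submodule.subset_span ⟨(m, n, k), rfl⟩)
  exact h1 Submodule.mem_top

theorem topologicalClosure_span_tmul_tmul' (M : CStarCorrespondence A B)
    (N : CStarCorrespondence B C) (K : CStarCorrespondence C D) :
    (Submodule.span ℂ (Set.range fun p : M.carrier × N.carrier × K.carrier =>
      M.tmul (N.tensor K) p.1 (N.tmul K p.2.1 p.2.2))).topologicalClosure = ⊤ := by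
  set S := (Submodule.span ℂ (Set.range fun p : M.carrier × N.carrier × K.carrier =>
      M.tmul (N.tensor K) p.1 (N.tmul K p.2.1 p.2.2))).topologicalClosure with hS
  have hcl : IsClosed (S : Set (M.tensor (N.tensor K)).carrier) :=
    Submodule.isClosed_topologicalClosure _
  rw [eq_top_iff, ← M.topologicalClosure_span_tmul (N.tensor K)]
  refine Submodule.topologicalClosure_minimal _ (Submodule.span_le.mpr ?_) hcl
  rintro _ ⟨⟨m, t⟩, rfl⟩
  have h1 : (⊤ : Submodule ℂ (N.tensor K).carrier) ≤
      S.comap (M.tmulL (N.tensor K) m).toLinearMap := by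
    rw [← N.topologicalClosure_span_tmul K]
    refine Submodule.topologicalClosure_minimal _ (Submodule.span_le.mpr ?_)
      (hcl.preimage (M.tmulL (N.tensor K) m).continuous)
    rintro _ ⟨⟨n, k⟩, rfl⟩
    exact Submodule.le_topologicalClosure _ (Submodule.subset_span ⟨(m, n, k), rfl⟩)
  exact h1 Submodule.mem_top

/-- The canonical isomorphism `(M ⊗_B N) ⊗_C K → M ⊗_B (N ⊗_C K)`,
`(m ⊗ n) ⊗ k ↦ m ⊗ (n ⊗ k)`. -/
def assoc (M : CStarCorrespondence A B) (N : CStarCorrespondence B C)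
    (K : CStarCorrespondence C D) :
    Iso ((M.tensor N).tensor K) (M.tensor (N.tensor K)) :=
  Iso.ofGenerators
    (fun p : M.carrier × N.carrier × K.carrier =>
      (M.tensor N).tmul K (M.tmul N p.1 p.2.1) p.2.2)
    (fun p => M.tmul (N.tensor K) p.1 (N.tmul K p.2.1 p.2.2))
    (topologicalClosure_span_tmul_tmul M N K) (topologicalClosure_span_tmul_tmul' M N K)
    (fun p q => by simp only [inner_tmul, left_tmul])
    (fun a p => ⟨(M.left a p.1, p.2.1, p.2.2), by simp only [left_tmul], by simp only [left_tmul]⟩)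

theorem assoc_tmul (M : CStarCorrespondence A B) (N : CStarCorrespondence B C)
    (K : CStarCorrespondence C D) (m : M.carrier) (n : N.carrier) (k : K.carrier) :
    assoc M N K ((M.tensor N).tmul K (M.tmul N m n) k) =
      M.tmul (N.tensor K) m (N.tmul K n k) :=
  Iso.ofGenerators_apply (fun p : M.carrier × N.carrier × K.carrier =>
      (M.tensor N).tmul K (M.tmul N p.1 p.2.1) p.2.2) _ _ _ _ _ (m, n, k)

/-- The identity correspondence `A` over `A`, with the inner product `⟨a, b⟩ = a⋆ b` and
multiplication as left and right action. -/
def identity (A : Type u) [NonUnitalCStarAlgebra A] : CStarCorrespondence A A where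
  carrier := A
  rsmul := LinearMap.mul ℂ A
  rsmul_mul x b c := (mul_assoc x b c).symm
  inner := LinearMap.mk₂'ₛₗ (starRingEnd ℂ) (RingHom.id ℂ) (fun a b => star a * b)
    (fun a b c => by rw [star_add, add_mul])
    (fun c a b => by rw [star_smul, smul_mul_assoc]; rfl)
    (fun a b c => mul_add _ _ _)
    (fun c a b => mul_smul_comm _ _ _)
  inner_rsmul x y b := (mul_assoc (star x) y b).symm
  star_inner x y := by
    change star (star x * y) = star y * x
    rw [star_mul, star_star]
  inner_self_nonneg x := ⟨x, rfl⟩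
  norm_sq_eq x := by
    change ‖x‖ ^ 2 = ‖star x * x‖
    rw [CStarRing.norm_star_mul_self, sq]
  left := NonUnitalAlgHom.Lmul ℂ A
  inner_left a x y := by
    change star (a * x) * y = star x * (star a * y)
    rw [star_mul, mul_assoc]
  nondegenerate := fun x => by
    obtain ⟨l, hl, _, h⟩ := exists_approximateUnit A
    exact mem_closure_of_tendsto (h x) (Filter.Eventually.of_forall fun e => ⟨e, x, rfl⟩)

theorem left_rsmul (M : CStarCorrespondence A B) (a : A) (m : M.carrier) (b : B) :
    M.left a (M.rsmul m b) = M.rsmul (M.left a m) b := by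
  refine M.ext_inner fun z => ?_
  rw [M.left_inner, M.inner_rsmul, M.inner_rsmul, M.left_inner]

/-- The products `m · b` are dense in a Hilbert module. -/
theorem dense_rsmul (M : CStarCorrespondence A B) :
    Dense (Set.range fun p : M.carrier × B => M.rsmul p.1 p.2) := by
  intro m
  obtain ⟨l, hl, hb, h⟩ := exists_approximateUnit B
  have hstar : ∀ b : B, Filter.Tendsto (fun e => b * star e) l (nhds b) := fun b => by
    have h1 := (continuous_star.tendsto _).comp (h (star b))
    rw [star_star] at h1
    refine h1.congr fun e => ?_
    simp
  refine mem_closure_of_tendsto (f := fun e => M.rsmul m (star e)) (b := l) ?_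
    (Filter.Eventually.of_forall fun e => ⟨(m, star e), rfl⟩)
  rw [tendsto_iff_norm_sub_tendsto_zero]
  have key : Filter.Tendsto
      (fun e => ‖e * (M.inner m m * star e - M.inner m m) - (M.inner m m * star e - M.inner m m)‖)
      l (nhds 0) := by
    have h1 : Filter.Tendsto (fun e => ‖M.inner m m * star e - M.inner m m‖) l (nhds 0) :=
      tendsto_iff_norm_sub_tendsto_zero.mp (hstar _)
    have h2 := h1.const_mul 2
    rw [mul_zero] at h2
    refine squeeze_zero' (Filter.Eventually.of_forall fun e => norm_nonneg _) ?_ h2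
    filter_upwards [hb] with e he
    refine (norm_sub_le _ _).trans ?_
    have h3 := norm_mul_le e (M.inner m m * star e - M.inner m m)
    have h4 := mul_le_of_le_one_left (norm_nonneg (M.inner m m * star e - M.inner m m)) he
    linarith
  have hsq : Filter.Tendsto (fun e => ‖M.rsmul m (star e) - m‖ ^ 2) l (nhds 0) := by
    refine key.congr fun e => ?_
    rw [M.norm_sq_eq]
    congr 1
    simp only [map_sub, LinearMap.sub_apply, M.rsmul_inner, M.inner_rsmul, star_star, mul_sub]
    abel
  have := (Real.continuous_sqrt.tendsto 0).comp hsq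
  rw [Real.sqrt_zero] at this
  exact this.congr fun e => Real.sqrt_sq (norm_nonneg _)

/-- The isomorphism `ι_r : M ⊗_B B → M`, `m ⊗ b ↦ m · b`. -/
def rid (M : CStarCorrespondence A B) : Iso (M.tensor (identity B)) M :=
  Iso.ofGenerators (fun p : M.carrier × B => M.tmul (identity B) p.1 p.2)
    (fun p => M.rsmul p.1 p.2) (M.topologicalClosure_span_tmul (identity B))
    (by
      rw [← Submodule.dense_iff_topologicalClosure_eq_top]
      exact M.dense_rsmul.mono Submodule.subset_span)
    (fun p q => by
      refine Eq.trans ?_ (M.inner_tmul (identity B) p.1 q.1 p.2 q.2).symm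
      rw [M.rsmul_inner, M.inner_rsmul]
      rfl)
    (fun a p => ⟨(M.left a p.1, p.2), M.left_tmul (identity B) a p.1 p.2,
      M.left_rsmul a p.1 p.2⟩)

theorem rid_tmul (M : CStarCorrespondence A B) (m : M.carrier) (b : B) :
    rid M (M.tmul (identity B) m b) = M.rsmul m b :=
  Iso.ofGenerators_apply (fun p : M.carrier × B => M.tmul (identity B) p.1 p.2)
    _ _ _ _ _ (m, b)

/-- The isomorphism `ι_l : A ⊗_A M → M`, `a ⊗ m ↦ a · m`. -/
def lid (M : CStarCorrespondence A B) : Iso ((identity A).tensor M) M :=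
  Iso.ofGenerators (fun p : A × M.carrier => (identity A).tmul M p.1 p.2)
    (fun p => M.left p.1 p.2) ((identity A).topologicalClosure_span_tmul M)
    (by
      rw [← Submodule.dense_iff_topologicalClosure_eq_top]
      refine M.nondegenerate.mono ?_
      rintro _ ⟨a, m, rfl⟩
      exact Submodule.subset_span ⟨(a, m), rfl⟩)
    (fun p q => by
      refine Eq.trans ?_ ((identity A).inner_tmul M p.1 q.1 p.2 q.2).symm
      change _ = M.inner p.2 (M.left (star p.1 * q.1) q.2)
      rw [M.inner_left, map_mul]
      rfl)
    (fun a p => ⟨(a * p.1, p.2), (identity A).left_tmul M a p.1 p.2, by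
      rw [map_mul]
      rfl⟩)

theorem lid_tmul (M : CStarCorrespondence A B) (a : A) (m : M.carrier) :
    lid M ((identity A).tmul M a m) = M.left a m :=
  Iso.ofGenerators_apply (fun p : A × M.carrier => (identity A).tmul M p.1 p.2)
    _ _ _ _ _ (a, m)

end CStarCorrespondence

namespace CStarCorrespondence

variable {A B : Type u} [NonUnitalCStarAlgebra A] [NonUnitalCStarAlgebra B]

/-- A correspondence is regular if the left action is injective and acts by compact operators. -/
def IsRegular (M : CStarCorrespondence A B) : Prop :=
  Function.Injective M.left ∧ ∀ a, M.left a ∈ M.compacts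

/-- The Katsura ideal `J_X = φ_X⁻¹(𝓚(X)) ∩ (ker φ_X)^⊥`. -/
def katsuraIdeal (X : CStarCorrespondence A A) : Set A :=
  {a | X.left a ∈ X.compacts ∧ ∀ b, X.left b = 0 → a * b = 0}

end CStarCorrespondence

/-- The objects of the category: a C⋆-algebra `A` with an `A`-`A` correspondence `X`. -/
structure ECCor where
  algebra : Type u
  [cstarAlgebra : NonUnitalCStarAlgebra algebra]
  corr : CStarCorrespondence algebra algebra

namespace ECCor

open CStarCorrespondence

attribute [instance] ECCor.cstarAlgebra

/-- A pair `(M, U_M)` of an `A`-`B` correspondence `M` and an isomorphism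
`U_M : X ⊗_A M → M ⊗_B Y` of `A`-`B` correspondences. -/
structure Pair (X Y : ECCor.{u}) where
  M : CStarCorrespondence X.algebra Y.algebra
  U : Iso (X.corr.tensor M) (M.tensor Y.corr)

namespace Pair

/-- The condition on a pair `(M, U_M)` to define a morphism: `M` is regular, and
`J_X · M ⊆ M · J_Y`. -/
def IsMorphism {X Y : ECCor.{u}} (p : Pair X Y) : Prop :=
  p.M.IsRegular ∧
    {z | ∃ a ∈ X.corr.katsuraIdeal, ∃ m, p.M.left a m = z} ⊆
      {z | ∃ m, ∃ b ∈ Y.corr.katsuraIdeal, p.M.rsmul m b = z}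

/-- The pairs `(M, U_M)` and `(N, U_N)` are isomorphic if there is an isomorphism `ξ : M → N` with
`U_N (1 ⊗ ξ) = (ξ ⊗ 1) U_M`. -/
def Isomorphic {X Y : ECCor.{u}} (p q : Pair X Y) : Prop :=
  ∃ ξ : Iso p.M q.M, ∀ t,
    q.U ((Iso.refl X.corr).tensor ξ t) = ξ.tensor (Iso.refl Y.corr) (p.U t)

theorem tensor_refl {A B C : Type u} [NonUnitalCStarAlgebra A] [NonUnitalCStarAlgebra B]
    [NonUnitalCStarAlgebra C] (M : CStarCorrespondence A B) (N : CStarCorrespondence B C)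
    (t : (M.tensor N).carrier) : (Iso.refl M).tensor (Iso.refl N) t = t :=
  Iso.ext_of_dense (M.topologicalClosure_span_tmul N)
    (e := (Iso.refl M).tensor (Iso.refl N)) (e' := Iso.refl _)
    (fun p => Iso.tensor_tmul _ _ p.1 p.2) t

theorem tensor_trans {A B C : Type u} [NonUnitalCStarAlgebra A] [NonUnitalCStarAlgebra B]
    [NonUnitalCStarAlgebra C] {M M' M'' : CStarCorrespondence A B}
    {N N' N'' : CStarCorrespondence B C} (ξ : Iso M M') (ξ' : Iso M' M'') (η : Iso N N')
    (η' : Iso N' N'') (t : (M.tensor N).carrier) :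
    (ξ.trans ξ').tensor (η.trans η') t = ξ'.tensor η' (ξ.tensor η t) :=
  Iso.ext_of_dense (M.topologicalClosure_span_tmul N)
    (e := (ξ.trans ξ').tensor (η.trans η')) (e' := (ξ.tensor η).trans (ξ'.tensor η'))
    (fun p => by
      rw [Iso.trans_apply, Iso.tensor_tmul, Iso.tensor_tmul, Iso.tensor_tmul]
      rfl) t

theorem tensor_symm {A B C : Type u} [NonUnitalCStarAlgebra A] [NonUnitalCStarAlgebra B]
    [NonUnitalCStarAlgebra C] {M M' : CStarCorrespondence A B}
    {N N' : CStarCorrespondence B C} (ξ : Iso M M') (η : Iso N N') (t : (M'.tensor N').carrier) :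
    ξ.symm.tensor η.symm t = (ξ.tensor η).symm t := by
  refine Iso.ext_of_dense (M'.topologicalClosure_span_tmul N')
    (e := ξ.symm.tensor η.symm) (e' := (ξ.tensor η).symm) (fun p => ?_) t
  have h : M'.tmul N' p.1 p.2 = ξ.tensor η (M.tmul N (ξ.symm p.1) (η.symm p.2)) := by
    rw [Iso.tensor_tmul, Iso.apply_symm_apply, Iso.apply_symm_apply]
  rw [Iso.tensor_tmul, h, Iso.symm_apply_apply]

theorem isomorphic_equivalence (X Y : ECCor.{u}) :
    Equivalence (Isomorphic (X := X) (Y := Y)) where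
  refl p := ⟨Iso.refl _, fun t => by rw [tensor_refl, tensor_refl]⟩
  symm := by
    rintro p q ⟨ξ, h⟩
    refine ⟨ξ.symm, fun t => ?_⟩
    have h1 : (Iso.refl X.corr).tensor ξ.symm t = ((Iso.refl X.corr).tensor ξ).symm t :=
      tensor_symm (Iso.refl X.corr) ξ t
    have h2 : ∀ s, ξ.symm.tensor (Iso.refl Y.corr) s = (ξ.tensor (Iso.refl Y.corr)).symm s :=
      tensor_symm ξ (Iso.refl Y.corr)
    have h3 := h (((Iso.refl X.corr).tensor ξ).symm t)
    rw [Iso.apply_symm_apply] at h3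
    rw [h1, h2, h3, Iso.symm_apply_apply]
  trans := by
    rintro p q r ⟨ξ, h⟩ ⟨η, k⟩
    refine ⟨ξ.trans η, fun t => ?_⟩
    have h1 : (Iso.refl X.corr).tensor (ξ.trans η) t =
        (Iso.refl X.corr).tensor η ((Iso.refl X.corr).tensor ξ t) :=
      tensor_trans (Iso.refl X.corr) (Iso.refl X.corr) ξ η t
    have h2 : ∀ s, (ξ.trans η).tensor (Iso.refl Y.corr) s =
        η.tensor (Iso.refl Y.corr) (ξ.tensor (Iso.refl Y.corr) s) :=
      tensor_trans ξ η (Iso.refl Y.corr) (Iso.refl Y.corr)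
    rw [h1, h2, k, h]

/-- The pair `(M ⊗_B N, U_{M ⊗ N})` with `U_{M ⊗ N} = (1_M ⊗ U_N)(U_M ⊗ 1_N)`, up to the
canonical associativity isomorphisms. -/
def comp {X Y Z : ECCor.{u}} (p : Pair X Y) (q : Pair Y Z) : Pair X Z where
  M := p.M.tensor q.M
  U := (assoc X.corr p.M q.M).symm.trans <|
    (p.U.tensor (Iso.refl q.M)).trans <|
    (assoc p.M Y.corr q.M).trans <|
    ((Iso.refl p.M).tensor q.U).trans
    (assoc p.M q.M Z.corr).symm

/-- The pair `(A, U_A)` with `U_A = ι_l⁻¹ ι_r : X ⊗_A A → X → A ⊗_A X`. -/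
def id (X : ECCor.{u}) : Pair X X where
  M := identity X.algebra
  U := (rid X.corr).trans (lid X.corr).symm

end Pair

/-- The setoid of isomorphism of pairs `(M, U_M)` which define a morphism. -/
instance pairSetoid (X Y : ECCor.{u}) : Setoid {p : Pair X Y // p.IsMorphism} where
  r p q := p.1.Isomorphic q.1
  iseqv := (Pair.isomorphic_equivalence X Y).comap Subtype.val

/-- The isomorphism classes `[M, U_M]` of pairs, with `M` regular and `J_X · M ⊆ M · J_Y`. -/
def Mor (X Y : ECCor.{u}) : Type (u + 1) := Quotient (pairSetoid X Y)

/-- The isomorphism class `[M, U_M]`. -/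
def cls {X Y : ECCor.{u}} (p : Pair X Y) (h : p.IsMorphism) : Mor X Y := Quotient.mk _ ⟨p, h⟩

end ECCor

end

/-!
# The category of C⋆-correspondences and isomorphism classes of pairs

Two independent facts carry the theorem.

*Coherence.* C⋆-algebras, correspondences and isomorphisms of correspondences form a bicategory,
with the balanced tensor product as composition: naturality of the canonical isomorphisms, the
pentagon and the triangle hold because isomorphisms of correspondences are isometric, hence
determined by their values on elementary tensors. An object `X` of `ECCor` is a 1-cell `A ⟶ A`, a
pair `(M, U_M)` is a square `X ≫ M ⟶ M ≫ Y`, and the composition of pairs is the pasting of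
squares. In any bicategory, pasting of squares is associative and unital up to the associator and
the unitors (`paste_assoc`, `unit_paste`, `paste_unit`) and respects isomorphisms of squares
(`paste_congr`), so that isomorphism classes form a category.

*Closure of the morphisms under composition.* For the regularity of `M ⊗ N`, compactness of
`φ_M(a) ⊗ 1` is the point. The operators `θ_{x,y} ⊗ 1` are compact because `φ_N(B) ⊆ 𝓚(N)`
(`tmulL_comp_contract_mem_compacts`), and `‖S ⊗ 1‖ ≤ ‖S‖` for adjointable `S` (`opNorm_le_of_tmul`)
lets one pass to norm limits. The condition `J_X · M ⊆ M · J_Y` is handled by a factorization: a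
vector `x` for which `⟨x, x⟩` lies in a closed ideal `J` is of the form `y · d` with `d ∈ J`
(`exists_eq_rsmul_of_inner_mem`). Hence `M · J_Y` is the closed subspace of the vectors all of whose
inner products lie in `J_Y`, and the condition for `M ⊗ N` need be checked on elementary tensors
only, where `a · (m ⊗ n) = (m' · b) ⊗ n = m' ⊗ (b · n) = (m' ⊗ n') · c`.
-/

noncomputable section

/-! ### Coherence of the balanced tensor product -/

namespace CStarCorrespondence

variable {A B C D E : Type u} [NonUnitalCStarAlgebra A] [NonUnitalCStarAlgebra B]
  [NonUnitalCStarAlgebra C] [NonUnitalCStarAlgebra D] [NonUnitalCStarAlgebra E]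

namespace Iso

variable {M N : CStarCorrespondence A B}

theorem ext {e e' : Iso M N} (h : ∀ m, e m = e' m) : e = e' := by
  obtain ⟨e, _, _⟩ := e
  obtain ⟨e', _, _⟩ := e'
  congr
  exact LinearEquiv.ext h

theorem map_rsmul (e : Iso M N) (m : M.carrier) (b : B) :
    e (M.rsmul m b) = N.rsmul (e m) b := by
  refine N.ext_inner fun z => ?_
  obtain ⟨w, rfl⟩ : ∃ w, e w = z := ⟨e.symm z, e.apply_symm_apply z⟩
  rw [e.inner_map, N.inner_rsmul, e.inner_map, M.inner_rsmul]

/-- In a commuting square of isomorphisms, one side in terms of the other three. -/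
theorem eq_trans_symm {M' N' : CStarCorrespondence A B} {f : Iso M N} {e : Iso M M'}
    {g : Iso M' N'} {e' : Iso N N'} (h : f.trans e' = e.trans g) :
    f = e.trans (g.trans e'.symm) :=
  Iso.ext fun m => by
    have := congrArg e'.symm (congrArg (fun k : Iso M N' => k m) h)
    exact (e'.symm_apply_apply (f m)).symm.trans this

/-- In a commuting square of isomorphisms, the side opposite to that of `eq_trans_symm` in terms of
the other three. -/
theorem eq_symm_trans {M' N' : CStarCorrespondence A B} {f : Iso M N} {e : Iso M M'}
    {g : Iso M' N'} {e' : Iso N N'} (h : f.trans e' = e.trans g) :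
    g = e.symm.trans (f.trans e') :=
  Iso.ext fun m => by
    rw [h, trans_apply, trans_apply, e.apply_symm_apply]

/-- An isomorphism is determined by its values on elementary tensors. -/
theorem ext_tmul {N : CStarCorrespondence B C} {K : CStarCorrespondence A C}
    {e e' : Iso (M.tensor N) K} (h : ∀ m n, e (M.tmul N m n) = e' (M.tmul N m n)) : e = e' :=
  Iso.ext fun t => Iso.ext_of_dense (M.topologicalClosure_span_tmul N) (fun p => h p.1 p.2) t

theorem ext_tmul_tmul {N : CStarCorrespondence B C} {K : CStarCorrespondence C D}
    {L : CStarCorrespondence A D} {e e' : Iso ((M.tensor N).tensor K) L}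
    (h : ∀ m n k, e ((M.tensor N).tmul K (M.tmul N m n) k) =
      e' ((M.tensor N).tmul K (M.tmul N m n) k)) : e = e' :=
  Iso.ext fun t => Iso.ext_of_dense (topologicalClosure_span_tmul_tmul M N K)
    (fun p => h p.1 p.2.1 p.2.2) t

end Iso

/-- The relation `m b ⊗ n = m ⊗ b n` that balances the tensor product over `B`. -/
theorem tmul_rsmul (M : CStarCorrespondence A B) (N : CStarCorrespondence B C) (m : M.carrier)
    (b : B) (n : N.carrier) : M.tmul N (M.rsmul m b) n = M.tmul N m (N.left b n) := by
  have h : ∀ x y, (M.tensor N).inner (M.tmul N x y) (M.tmul N (M.rsmul m b) n) =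
      (M.tensor N).inner (M.tmul N x y) (M.tmul N m (N.left b n)) := fun x y => by
    rw [inner_tmul, inner_tmul, M.inner_rsmul, map_mul]
    rfl
  rw [← sub_eq_zero, ← norm_eq_zero, ← sq_eq_zero_iff, HilbertModule.norm_sq_eq, norm_eq_zero]
  simp only [map_sub, LinearMap.sub_apply, h, sub_self]

theorem assoc_naturality {M M' : CStarCorrespondence A B} {N N' : CStarCorrespondence B C}
    {K K' : CStarCorrespondence C D} (ξ : Iso M M') (η : Iso N N') (ζ : Iso K K') :
    ((ξ.tensor η).tensor ζ).trans (assoc M' N' K') =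
      (assoc M N K).trans (ξ.tensor (η.tensor ζ)) :=
  Iso.ext_tmul_tmul fun m n k => by
    simp only [Iso.trans_apply, Iso.tensor_tmul, assoc_tmul]

theorem rid_naturality {M M' : CStarCorrespondence A B} (ξ : Iso M M') :
    (ξ.tensor (Iso.refl (identity B))).trans (rid M') = (rid M).trans ξ :=
  Iso.ext_tmul fun m b => by
    rw [Iso.trans_apply, Iso.tensor_tmul]
    exact (rid_tmul M' (ξ m) b).trans
      ((ξ.map_rsmul m b).symm.trans (congrArg ξ (rid_tmul M m b).symm))

theorem lid_naturality {M M' : CStarCorrespondence A B} (ξ : Iso M M') :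
    ((Iso.refl (identity A)).tensor ξ).trans (lid M') = (lid M).trans ξ :=
  Iso.ext_tmul fun a m => by
    rw [Iso.trans_apply, Iso.tensor_tmul]
    exact (lid_tmul M' a (ξ m)).trans
      ((ξ.map_left a m).symm.trans (congrArg ξ (lid_tmul M a m).symm))

theorem assoc_pentagon (M : CStarCorrespondence A B) (N : CStarCorrespondence B C)
    (K : CStarCorrespondence C D) (L : CStarCorrespondence D E) :
    ((assoc M N K).tensor (Iso.refl L)).trans
        ((assoc M (N.tensor K) L).trans ((Iso.refl M).tensor (assoc N K L))) =
      (assoc (M.tensor N) K L).trans (assoc M N (K.tensor L)) := by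
  -- For fixed `l`, both sides are bounded linear in the first factor of `t ⊗ l`, so that
  -- `t = (m ⊗ n) ⊗ k` suffices.
  have key : ∀ {e e' : Iso (((M.tensor N).tensor K).tensor L) (M.tensor (N.tensor (K.tensor L)))},
      (∀ m n k l, e (((M.tensor N).tensor K).tmul L ((M.tensor N).tmul K (M.tmul N m n) k) l) =
        e' (((M.tensor N).tensor K).tmul L ((M.tensor N).tmul K (M.tmul N m n) k) l)) →
      e = e' := by
    intro e e' h
    refine Iso.ext_tmul fun t l => ?_
    have hl := ((((M.tensor N).tensor K).tmulL L).flip l).continuous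
    refine congrFun (Continuous.ext_on (Submodule.dense_iff_topologicalClosure_eq_top.mpr
      (topologicalClosure_span_tmul_tmul M N K)) (e.continuous.comp hl) (e'.continuous.comp hl) ?_)
      t
    refine LinearMap.eqOn_span
      (f := e.toEquiv.toLinearMap ∘ₗ (((M.tensor N).tensor K).tmul L).flip l)
      (g := e'.toEquiv.toLinearMap ∘ₗ (((M.tensor N).tensor K).tmul L).flip l) ?_
    rintro _ ⟨⟨m, n, k⟩, rfl⟩
    exact h m n k l
  refine key fun m n k l => ?_
  simp only [Iso.trans_apply, Iso.tensor_tmul, assoc_tmul]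
  rfl

theorem assoc_triangle (M : CStarCorrespondence A B) (N : CStarCorrespondence B C) :
    (assoc M (identity B) N).trans ((Iso.refl M).tensor (lid N)) =
      (rid M).tensor (Iso.refl N) :=
  Iso.ext_tmul_tmul fun m b n => by
    rw [Iso.trans_apply, assoc_tmul, Iso.tensor_tmul, Iso.tensor_tmul]
    refine (congrArg (M.tmul N m) (lid_tmul N b n)).trans ((tmul_rsmul M N m b n).symm.trans ?_)
    exact congrArg (fun x => M.tmul N x n) (rid_tmul M m b).symm

theorem tensor_exchange {M M' : CStarCorrespondence A B} {N N' : CStarCorrespondence B C}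
    (ξ : Iso M M') (η : Iso N N') :
    ((Iso.refl M).tensor η).trans (ξ.tensor (Iso.refl N')) =
      (ξ.tensor (Iso.refl N)).trans ((Iso.refl M').tensor η) :=
  Iso.ext_tmul fun m n => by
    simp only [Iso.trans_apply, Iso.tensor_tmul]
    rfl

theorem tensor_refl_refl (M : CStarCorrespondence A B) (N : CStarCorrespondence B C) :
    (Iso.refl M).tensor (Iso.refl N) = Iso.refl (M.tensor N) :=
  Iso.ext (ECCor.Pair.tensor_refl M N)

end CStarCorrespondence

/-! ### The bicategory of correspondences -/

open CategoryTheory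

/-- A C⋆-algebra, not necessarily unital, as an object of the bicategory of correspondences. -/
structure BundledCStarAlgebra where
  carrier : Type u
  [cstarAlgebra : NonUnitalCStarAlgebra carrier]

namespace BundledCStarAlgebra

open CStarCorrespondence

attribute [instance] BundledCStarAlgebra.cstarAlgebra

/-- The 1-cells `A ⟶ B` are the `A`-`B` correspondences, composed by the balanced tensor
product. -/
instance : CategoryStruct BundledCStarAlgebra.{u} where
  Hom A B := CStarCorrespondence A.carrier B.carrier
  id A := identity A.carrier
  comp M N := M.tensor N

/-- The 2-cells are the isomorphisms of correspondences. -/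
instance homCategory (A B : BundledCStarAlgebra.{u}) : Category (A ⟶ B) where
  Hom M N := CStarCorrespondence.Iso M N
  id M := CStarCorrespondence.Iso.refl M
  comp e f := e.trans f

/-- An isomorphism of correspondences as an invertible 2-cell. -/
def isoOf {A B : BundledCStarAlgebra.{u}} {M N : A ⟶ B} (e : CStarCorrespondence.Iso M N) :
    M ≅ N where
  hom := e
  inv := e.symm
  hom_inv_id := CStarCorrespondence.Iso.ext e.symm_apply_apply
  inv_hom_id := CStarCorrespondence.Iso.ext e.apply_symm_apply

/-- The bicategory of C⋆-algebras, correspondences and isomorphisms of correspondences. -/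
instance : Bicategory BundledCStarAlgebra.{u} where
  homCategory := homCategory
  whiskerLeft M _ _ η := (CStarCorrespondence.Iso.refl M).tensor η
  whiskerRight ξ N := CStarCorrespondence.Iso.tensor ξ (CStarCorrespondence.Iso.refl N)
  associator M N K := isoOf (assoc M N K)
  leftUnitor M := isoOf (lid M)
  rightUnitor M := isoOf (rid M)
  whiskerLeft_id M N := tensor_refl_refl M N
  whiskerLeft_comp M _ _ _ η η' := CStarCorrespondence.Iso.ext
    (ECCor.Pair.tensor_trans (CStarCorrespondence.Iso.refl M) (CStarCorrespondence.Iso.refl M)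
      η η')
  id_whiskerLeft η := CStarCorrespondence.Iso.eq_trans_symm (lid_naturality η)
  comp_whiskerLeft M N _ _ η := CStarCorrespondence.Iso.eq_trans_symm <| by
    refine Eq.trans ?_ (assoc_naturality (.refl M) (.refl N) η)
    rw [tensor_refl_refl]
    rfl
  id_whiskerRight M N := tensor_refl_refl M N
  comp_whiskerRight ξ ξ' N := CStarCorrespondence.Iso.ext
    (ECCor.Pair.tensor_trans ξ ξ' (CStarCorrespondence.Iso.refl N)
      (CStarCorrespondence.Iso.refl N))
  whiskerRight_id ξ := CStarCorrespondence.Iso.eq_trans_symm (rid_naturality ξ)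
  whiskerRight_comp ξ N K := CStarCorrespondence.Iso.eq_symm_trans <| by
    refine (assoc_naturality ξ (.refl N) (.refl K)).trans ?_
    rw [tensor_refl_refl]
    rfl
  whisker_assoc M _ _ η K := CStarCorrespondence.Iso.eq_trans_symm
    (assoc_naturality (.refl M) η (.refl K))
  whisker_exchange ξ η := tensor_exchange ξ η
  pentagon := assoc_pentagon
  triangle := assoc_triangle

end BundledCStarAlgebra

/-! ### Pasting of squares in a bicategory -/

namespace CategoryTheory.Bicategory

variable {𝒞 : Type*} [Bicategory 𝒞] {a b c d : 𝒞} {X : a ⟶ a} {Y : b ⟶ b} {Z : c ⟶ c} {W : d ⟶ d}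

/-- The horizontal pasting of two squares `X ≫ M ⟶ M ≫ Y` and `Y ≫ N ⟶ N ≫ Z`. For
correspondences this is the formula `(1_M ⊗ U_N)(U_M ⊗ 1_N)` of `ECCor.Pair.comp`. -/
def pasteSquares {M : a ⟶ b} {N : b ⟶ c} (U : X ≫ M ⟶ M ≫ Y) (V : Y ≫ N ⟶ N ≫ Z) :
    X ≫ M ≫ N ⟶ (M ≫ N) ≫ Z :=
  (α_ X M N).inv ≫ U ▷ N ≫ (α_ M Y N).hom ≫ M ◁ V ≫ (α_ M N Z).inv

theorem paste_unit {M : a ⟶ b} (U : X ≫ M ⟶ M ≫ Y) :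
    X ◁ (ρ_ M).hom ≫ U =
      pasteSquares U ((ρ_ Y).hom ≫ (λ_ Y).inv) ≫ (ρ_ M).hom ▷ Y := by
  unfold pasteSquares
  bicategory

theorem unit_paste {M : a ⟶ b} (U : X ≫ M ⟶ M ≫ Y) :
    X ◁ (λ_ M).hom ≫ U =
      pasteSquares ((ρ_ X).hom ≫ (λ_ X).inv) U ≫ (λ_ M).hom ▷ Y := by
  unfold pasteSquares
  bicategory

/-- Up to coherence, both sides are the composite of the whiskered 2-cells `U`, `V` and `T`, in this
order. -/
theorem paste_assoc {M : a ⟶ b} {N : b ⟶ c} {K : c ⟶ d} (U : X ≫ M ⟶ M ≫ Y)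
    (V : Y ≫ N ⟶ N ≫ Z) (T : Z ≫ K ⟶ K ≫ W) :
    X ◁ (α_ M N K).hom ≫ pasteSquares U (pasteSquares V T) =
      pasteSquares (pasteSquares U V) T ≫ (α_ M N K).hom ▷ W := by
  unfold pasteSquares
  bicategory

/-- Pasting respects isomorphisms of squares, by the interchange law applied once before and once
after the hypotheses. -/
theorem paste_congr {M M' : a ⟶ b} {N N' : b ⟶ c} {U : X ≫ M ⟶ M ≫ Y} {V : Y ≫ N ⟶ N ≫ Z}
    {U' : X ≫ M' ⟶ M' ≫ Y} {V' : Y ≫ N' ⟶ N' ≫ Z} {ξ : M ⟶ M'} {η : N ⟶ N'}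
    (hξ : X ◁ ξ ≫ U' = U ≫ ξ ▷ Y) (hη : Y ◁ η ≫ V' = V ≫ η ▷ Z) :
    X ◁ (ξ ▷ N ≫ M' ◁ η) ≫ pasteSquares U' V' =
      pasteSquares U V ≫ (ξ ▷ N ≫ M' ◁ η) ▷ Z := by
  unfold pasteSquares
  calc _ = 𝟙 _ ⊗≫ X ◁ ξ ▷ N ⊗≫ ((X ≫ M') ◁ η ≫ U' ▷ N') ⊗≫ M' ◁ V' ⊗≫ 𝟙 _ := by bicategory
    _ = 𝟙 _ ⊗≫ (X ◁ ξ ≫ U') ▷ N ⊗≫ M' ◁ (Y ◁ η ≫ V') ⊗≫ 𝟙 _ := by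
      rw [whisker_exchange]; bicategory
    _ = 𝟙 _ ⊗≫ U ▷ N ⊗≫ (ξ ▷ (Y ≫ N) ≫ M' ◁ V) ⊗≫ M' ◁ η ▷ Z ⊗≫ 𝟙 _ := by
      rw [hξ, hη]; bicategory
    _ = _ := by rw [← whisker_exchange]; bicategory

end CategoryTheory.Bicategory

end

noncomputable section

/-! ### Factorization in Hilbert modules -/

/-- A self-adjoint element `d` lies in the closure of the right ideal generated by `d⁴`. -/
theorem IsSelfAdjoint.mem_closure_pow_four_mul {B : Type*} [NonUnitalCStarAlgebra B] {d : B}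
    (hd : IsSelfAdjoint d) :
    d ∈ closure (Set.range fun k => d * d * (d * d) * k) := by
  refine Metric.mem_closure_range_iff.mpr fun ε hε => ?_
  -- The function `s ↦ s⁵ / (s⁴ + δ⁴)` differs from `s` by at most `δ`.
  set δ := ε / 2 with hδ
  have hδ0 : 0 < δ := by positivity
  have hpos : ∀ s : ℝ, s ^ 4 + δ ^ 4 ≠ 0 := fun s => by positivity
  let f : ℝ → ℝ := fun s => s / (s ^ 4 + δ ^ 4)
  have hf : Continuous f := continuous_id.div (by fun_prop) hpos
  have hf0 : f 0 = 0 := by simp [f]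
  have hid : ∀ g : ℝ → ℝ, Continuous g → g 0 = 0 → d * cfcₙ g d = cfcₙ (fun s => s * g s) d := by
    intro g hg hg0
    conv_lhs => rw [← cfcₙ_id' ℝ d]
    rw [cfcₙ_mul (fun s => s) g d]
    simp [cfcₙ_id' ℝ d hd]
  refine ⟨cfcₙ f d, ?_⟩
  have h1 : d * d * (d * d) * cfcₙ f d = cfcₙ (fun s => s * (s * (s * (s * f s)))) d := by
    rw [← hid _ (by fun_prop) (by simp), ← hid _ (by fun_prop) (by simp),
      ← hid _ (by fun_prop) (by simp), ← hid _ hf hf0]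
    simp only [mul_assoc]
  have h2 : d - d * d * (d * d) * cfcₙ f d =
      cfcₙ (fun s => s - s * (s * (s * (s * f s)))) d := by
    rw [cfcₙ_sub (fun s : ℝ => s) _ d, h1, cfcₙ_id' ℝ d]
  rw [dist_eq_norm, h2]
  refine (norm_cfcₙ_le (c := δ) fun s _ => ?_).trans_lt (by linarith)
  have h3 : s - s * (s * (s * (s * f s))) = s * δ ^ 4 / (s ^ 4 + δ ^ 4) := by
    simp only [f]
    field_simp [hpos s]
    ring
  rw [h3, Real.norm_eq_abs, abs_div, abs_mul, abs_of_pos (show 0 < s ^ 4 + δ ^ 4 by positivity),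
    abs_of_pos (show 0 < δ ^ 4 by positivity), div_le_iff₀ (by positivity)]
  have hs4 : s ^ 4 = |s| ^ 4 := by rw [pow_abs, abs_of_nonneg (by positivity)]
  rw [hs4]
  have hs := abs_nonneg s
  generalize |s| = r at hs
  rcases le_total r δ with h | h
  · have : r * δ ^ 4 ≤ δ * δ ^ 4 := by gcongr
    nlinarith [show 0 ≤ δ * r ^ 4 by positivity]
  · have : r * δ ^ 3 ≤ r * r ^ 3 := by gcongr
    nlinarith [show 0 ≤ δ * δ ^ 4 by positivity]

namespace HilbertModule

variable {B : Type u} [NonUnitalCStarAlgebra B] (X : HilbertModule B)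

section

attribute [local instance] CStarAlgebra.spectralOrder CStarAlgebra.spectralOrderedRing

/-- An element of the form `b⋆ b` has a self-adjoint fourth root. -/
theorem exists_fourth_root (b : B) : ∃ d : B, IsSelfAdjoint d ∧ star b * b = d * d * (d * d) := by
  have h : 0 ≤ star b * b := star_mul_self_nonneg b
  refine ⟨CFC.sqrt (CFC.sqrt (star b * b)), IsSelfAdjoint.of_nonneg (CFC.sqrt_nonneg _), ?_⟩
  rw [CFC.sqrt_mul_sqrt_self _ (CFC.sqrt_nonneg _), CFC.sqrt_mul_sqrt_self _ h]

end

/-- If `⟨x, x⟩` lies in a closed right ideal `J` (a closed set with `J B ⊆ J`; additivity plays no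
role), then `x` factors as `y · d` with `d ∈ J`: here `d = ⟨x, x⟩ ^ (1/4)`. -/
theorem exists_eq_rsmul_of_inner_mem {J : Set B} (hJ : IsClosed J)
    (hmul : ∀ a ∈ J, ∀ c, a * c ∈ J) {x : X.carrier} (hx : X.inner x x ∈ J) :
    ∃ y, ∃ d ∈ J, X.rsmul y d = x := by
  obtain ⟨b, hb⟩ := X.inner_self_nonneg x
  obtain ⟨d, hd, hbd⟩ := exists_fourth_root b
  have ha : X.inner x x = d * d * (d * d) := hb.trans hbd
  have hds : star d = d := hd
  have hcl := hd.mem_closure_pow_four_mul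
  have hdJ : d ∈ J := by
    refine hJ.closure_subset_iff.mpr ?_ hcl
    rintro _ ⟨k, rfl⟩
    exact hmul _ (ha ▸ hx) k
  obtain ⟨s, hs, hlim⟩ := mem_closure_iff_seq_limit.mp hcl
  choose k hk using hs
  simp only at hk
  -- `|x| = d²`, so that `r ↦ x · r` and `r ↦ d² r` have the same norms.
  have hnorm : ∀ r, ‖X.rsmul x r‖ = ‖d * d * r‖ := by
    intro r
    rw [← sq_eq_sq₀ (norm_nonneg _) (norm_nonneg _), X.norm_sq_eq, X.rsmul_inner, X.inner_rsmul,
      ha, sq, ← CStarRing.norm_star_mul_self]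
    simp only [star_mul, hds, mul_assoc]
  have hnorm' : ∀ r, ‖X.rsmul x r - x‖ = ‖d * d * r - d * d‖ := by
    intro r
    rw [← sq_eq_sq₀ (norm_nonneg _) (norm_nonneg _), X.norm_sq_eq, sq,
      ← CStarRing.norm_star_mul_self]
    simp only [map_sub, LinearMap.sub_apply, X.rsmul_inner, X.inner_rsmul, ha, star_sub, star_mul,
      hds, mul_assoc, mul_sub, sub_mul]
  have hsk : ∀ n, d * d * (d * d * k n) = s n := fun n => by rw [← mul_assoc]; exact hk n
  have hcauchy : CauchySeq fun n => X.rsmul x (d * d * k n) := by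
    rw [Metric.cauchySeq_iff]
    intro ε hε
    obtain ⟨N, hN⟩ := Metric.cauchySeq_iff.mp hlim.cauchySeq ε hε
    refine ⟨N, fun m hm n hn => ?_⟩
    rw [dist_eq_norm, ← map_sub, hnorm, mul_sub, hsk, hsk, ← dist_eq_norm]
    exact hN m hm n hn
  obtain ⟨y, hy⟩ := cauchySeq_tendsto_of_complete hcauchy
  refine ⟨y, d, hdJ, tendsto_nhds_unique (f := fun n => X.rsmul x (d * d * k n * d))
    (l := Filter.atTop) ?_ ?_⟩
  · have h1 : Continuous fun z => X.rsmulL z d := by fun_prop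
    refine ((h1.tendsto y).comp hy).congr fun n => ?_
    exact (X.rsmul_mul x (d * d * k n) d).symm
  · rw [tendsto_iff_norm_sub_tendsto_zero]
    simp only [hnorm']
    rw [← tendsto_iff_norm_sub_tendsto_zero]
    refine (hlim.mul_const d).congr fun n => ?_
    rw [← hsk, mul_assoc (d * d)]

/-- A Hilbert module over `B` and a closed ideal `J` of `B`: `z ∈ X · J` if and only if all the
inner products `⟨w, z⟩` lie in `J`. -/
theorem exists_eq_rsmul_iff {J : Set B} (hJ : IsClosed J) (hmul : ∀ a ∈ J, ∀ c, a * c ∈ J)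
    (hmul' : ∀ c, ∀ a ∈ J, c * a ∈ J) {z : X.carrier} :
    (∃ y, ∃ d ∈ J, X.rsmul y d = z) ↔ ∀ w, X.inner w z ∈ J := by
  constructor
  · rintro ⟨y, d, hd, rfl⟩ w
    rw [X.inner_rsmul]
    exact hmul' _ _ hd
  · exact fun h => X.exists_eq_rsmul_of_inner_mem hJ hmul (h z)

end HilbertModule

end

noncomputable section

/-! ### Compact operators and the Katsura ideal -/

namespace HilbertModule

variable {B : Type u} [NonUnitalCStarAlgebra B] (X : HilbertModule B)

theorem theta_mem_compacts (x y : X.carrier) : X.theta x y ∈ X.compacts :=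
  Submodule.le_topologicalClosure _ (Submodule.subset_span ⟨x, y, rfl⟩)

theorem isClosed_compacts : IsClosed (X.compacts : Set (X.carrier →L[ℂ] X.carrier)) :=
  Submodule.isClosed_topologicalClosure _

/-- A closed linear subspace which contains the operators `θ_{x,y}` contains `𝓚(X)`. -/
theorem compacts_le {S : Submodule ℂ (X.carrier →L[ℂ] X.carrier)}
    (hS : IsClosed (S : Set (X.carrier →L[ℂ] X.carrier))) (h : ∀ x y, X.theta x y ∈ S) :
    X.compacts ≤ S := by
  refine Submodule.topologicalClosure_minimal _ (Submodule.span_le.mpr ?_) hS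
  rintro _ ⟨x, y, rfl⟩
  exact h x y

end HilbertModule

namespace CStarCorrespondence

variable {A B C : Type u} [NonUnitalCStarAlgebra A] [NonUnitalCStarAlgebra B]
  [NonUnitalCStarAlgebra C]

/-- The left action as a bounded linear map. -/
def leftL (X : CStarCorrespondence A B) : A →L[ℂ] X.carrier →L[ℂ] X.carrier :=
  LinearMap.mkContinuous
    { toFun := X.left
      map_add' := map_add X.left
      map_smul' := map_smul X.left } 1 fun a => by
    rw [one_mul]
    exact (X.left a).opNorm_le_bound (norm_nonneg a) (X.norm_left_le a)

theorem leftL_apply (X : CStarCorrespondence A B) (a : A) : X.leftL a = X.left a := rfl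

theorem left_comp_mem_compacts (X : CStarCorrespondence A B) (a : A)
    {T : X.carrier →L[ℂ] X.carrier} (hT : T ∈ X.compacts) : X.left a ∘L T ∈ X.compacts := by
  let Φ := ContinuousLinearMap.compL ℂ X.carrier X.carrier X.carrier (X.left a)
  refine X.compacts_le (S := X.compacts.comap Φ.toLinearMap)
    (X.isClosed_compacts.preimage Φ.continuous) (fun x y => ?_) hT
  have : X.left a ∘L X.theta x y = X.theta (X.left a x) y := by
    ext z
    exact X.left_rsmul a x _
  exact (congrArg (· ∈ X.compacts) this).mpr (X.theta_mem_compacts _ _)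

theorem comp_left_mem_compacts (X : CStarCorrespondence A B) (a : A)
    {T : X.carrier →L[ℂ] X.carrier} (hT : T ∈ X.compacts) : T ∘L X.left a ∈ X.compacts := by
  let Φ := (ContinuousLinearMap.compL ℂ X.carrier X.carrier X.carrier).flip (X.left a)
  refine X.compacts_le (S := X.compacts.comap Φ.toLinearMap)
    (X.isClosed_compacts.preimage Φ.continuous) (fun x y => ?_) hT
  have : X.theta x y ∘L X.left a = X.theta x (X.left (star a) y) := by
    ext z
    exact congrArg (X.rsmul x) (X.left_inner a y z)
  exact (congrArg (· ∈ X.compacts) this).mpr (X.theta_mem_compacts _ _)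

section Katsura

variable (X : CStarCorrespondence A A)

/-- The Katsura ideal as a linear subspace. -/
def katsuraSubmodule : Submodule ℂ A where
  carrier := X.katsuraIdeal
  add_mem' {a b} ha hb := ⟨by rw [map_add]; exact add_mem ha.1 hb.1, fun c hc => by
    rw [add_mul, ha.2 c hc, hb.2 c hc, add_zero]⟩
  zero_mem' := ⟨by rw [map_zero]; exact zero_mem _, fun c _ => zero_mul c⟩
  smul_mem' r a ha := ⟨by rw [map_smul]; exact Submodule.smul_mem _ r ha.1, fun c hc => by
    rw [smul_mul_assoc, ha.2 c hc, smul_zero]⟩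

theorem isClosed_katsuraIdeal : IsClosed X.katsuraIdeal := by
  have h1 : IsClosed {a | X.left a ∈ X.compacts} :=
    X.isClosed_compacts.preimage X.leftL.continuous
  have h2 : IsClosed {a : A | ∀ b, X.left b = 0 → a * b = 0} := by
    simp only [Set.ofPred_forall]
    exact isClosed_iInter fun b => isClosed_iInter fun _ =>
      isClosed_eq (continuous_mul_const b) continuous_const
  exact h1.inter h2

theorem mul_mem_katsuraIdeal_right {a : A} (ha : a ∈ X.katsuraIdeal) (c : A) :
    a * c ∈ X.katsuraIdeal := by
  refine ⟨?_, fun b hb => ?_⟩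
  · rw [map_mul]
    exact X.comp_left_mem_compacts c ha.1
  · rw [mul_assoc, ha.2]
    rw [map_mul, hb, mul_zero]

theorem mul_mem_katsuraIdeal_left {a : A} (ha : a ∈ X.katsuraIdeal) (c : A) :
    c * a ∈ X.katsuraIdeal := by
  refine ⟨?_, fun b hb => ?_⟩
  · rw [map_mul]
    exact X.left_comp_mem_compacts c ha.1
  · rw [mul_assoc, ha.2 b hb, mul_zero]

/-- `M · J_Y` consists of the vectors all of whose inner products lie in `J_Y`. -/
theorem exists_rsmul_katsuraIdeal_iff {Y : CStarCorrespondence B B} {M : HilbertModule B}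
    {z : M.carrier} :
    (∃ m, ∃ b ∈ Y.katsuraIdeal, M.rsmul m b = z) ↔ ∀ w, M.inner w z ∈ Y.katsuraIdeal :=
  M.exists_eq_rsmul_iff Y.isClosed_katsuraIdeal
    (fun _ ha c => Y.mul_mem_katsuraIdeal_right ha c)
    (fun c _ ha => Y.mul_mem_katsuraIdeal_left ha c)

end Katsura


end CStarCorrespondence

/-! ### Operators on balanced tensor products -/

/-- A sequence with `s k ^ 2 ≤ s 0 * s (2 k)` and `s k ≤ K r ^ k` satisfies `s 1 ≤ r * s 0`: the
constant `K` disappears on taking roots of order `2 ^ n`. -/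
theorem le_mul_of_sq_le_of_le_mul_pow {s : ℕ → ℝ} {r K : ℝ} (hs : ∀ k, 0 ≤ s k)
    (hr : 0 ≤ r) (hsq : ∀ k, s k ^ 2 ≤ s 0 * s (2 * k)) (hK : ∀ k, s k ≤ K * r ^ k) :
    s 1 ≤ r * s 0 := by
  rcases (hs 0).eq_or_lt with h0 | h0
  · have h1 := hsq 1
    rw [← h0, zero_mul] at h1
    have : s 1 = 0 := pow_eq_zero_iff two_ne_zero |>.mp (le_antisymm h1 (sq_nonneg _))
    rw [this, ← h0, mul_zero]
  by_contra! hlt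
  set q := s 1 / s 0 with hq
  have hrq : r < q := by rwa [hq, lt_div_iff₀ h0]
  have hind : ∀ n, q ^ 2 ^ n ≤ s (2 ^ n) / s 0 := by
    intro n
    induction n with
    | zero => simp [hq]
    | succ n ih =>
      rw [pow_succ, pow_mul]
      refine (pow_le_pow_left₀ (pow_nonneg (hr.trans hrq.le) _) ih 2).trans ?_
      rw [div_pow, div_le_div_iff₀ (by positivity) h0, mul_comm (2 ^ n) 2]
      nlinarith [hsq (2 ^ n)]
  rcases hr.eq_or_lt with hr0 | hr0
  · have h1 := hK 1
    rw [← hr0, pow_one, mul_zero] at h1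
    rw [← hr0, zero_mul] at hlt
    linarith
  · obtain ⟨n, hn⟩ := pow_unbounded_of_one_lt (K / s 0) ((one_lt_div hr0).mpr hrq)
    have h1 : (q / r) ^ n ≤ (q / r) ^ 2 ^ n :=
      pow_le_pow_right₀ ((one_lt_div hr0).mpr hrq).le Nat.lt_two_pow_self.le
    have h2 := (hind n).trans (div_le_div_of_nonneg_right (hK (2 ^ n)) h0.le)
    rw [div_pow q r, div_pow q r] at h1
    have h3 : q ^ 2 ^ n / r ^ 2 ^ n ≤ K / s 0 := by
      rw [div_le_iff₀ (by positivity)]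
      exact h2.trans_eq (by ring)
    rw [div_pow q r] at hn
    linarith

namespace CStarCorrespondence

variable {A B C : Type u} [NonUnitalCStarAlgebra A] [NonUnitalCStarAlgebra B]
  [NonUnitalCStarAlgebra C]

section Tensor

variable (M : CStarCorrespondence A B) (N : CStarCorrespondence B C)

theorem norm_preMk_le (x : M.carrier) (y : N.carrier) : ‖M.preMk N x y‖ ≤ ‖x‖ * ‖y‖ := by
  have h : ‖M.mkC N x y‖ = ‖M.preMk N x y‖ := UniformSpace.Completion.norm_coe _
  exact h ▸ M.norm_mkC_le N x y

/-- The estimate `‖(S ⊗ 1) t‖ ^ 2 = ‖⟨t, (S⋆ S ⊗ 1) t⟩‖ ≤ ‖t‖ ‖(S⋆ S ⊗ 1) t‖`. -/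
theorem norm_sq_preTensorMap_le {S T : M.carrier →ₗ[ℂ] M.carrier}
    (hadj : ∀ x u, M.inner (S x) u = M.inner x (T u)) (t : (M.preTensor N).carrier) :
    ‖M.preTensorMap N S t‖ ^ 2 ≤ ‖t‖ * ‖M.preTensorMap N (T ∘ₗ S) t‖ := by
  rw [PreHilbertModule.norm_sq_eq, M.preTensorMap_inner N S T hadj]
  have : M.preTensorMap N T (M.preTensorMap N S t) = M.preTensorMap N (T ∘ₗ S) t :=
    (LinearMap.rTensor_comp_apply _ _ _ _).symm
  rw [this]
  exact PreHilbertModule.norm_inner_le _ _ _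

/-- For a self-adjoint operator, `‖T ⊗ 1‖ ≤ ‖T‖`. A crude bound for `‖(T ^ k ⊗ 1) t‖` is enough,
by the inequality `‖(T ^ k ⊗ 1) t‖ ^ 2 ≤ ‖t‖ ‖(T ^ (2 k) ⊗ 1) t‖`. -/
theorem norm_preTensorMap_le_of_symmetric {T : M.carrier →ₗ[ℂ] M.carrier}
    (hT : ∀ x u, M.inner (T x) u = M.inner x (T u)) {c : ℝ} (hc : 0 ≤ c)
    (hTc : ∀ x, ‖T x‖ ≤ c * ‖x‖) (t : (M.preTensor N).carrier) :
    ‖M.preTensorMap N T t‖ ≤ c * ‖t‖ := by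
  obtain ⟨F, hF⟩ := M.exists_sum_preMk N t
  have hpow : ∀ k x, ‖(T ^ k) x‖ ≤ c ^ k * ‖x‖ := by
    intro k
    induction k with
    | zero => intro x; simp
    | succ k ih =>
      intro x
      rw [pow_succ', Module.End.mul_apply]
      refine (hTc _).trans ((mul_le_mul_of_nonneg_left (ih x) hc).trans_eq ?_)
      ring
  have hsymm : ∀ k x u, M.inner ((T ^ k) x) u = M.inner x ((T ^ k) u) := by
    intro k
    induction k with
    | zero => intro x u; rfl
    | succ k ih =>
      intro x u
      rw [pow_succ', Module.End.mul_apply, hT, ih, ← Module.End.mul_apply, ← pow_succ, pow_succ']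
  have h := le_mul_of_sq_le_of_le_mul_pow (s := fun k => ‖M.preTensorMap N (T ^ k) t‖)
    (r := c) (K := ∑ p ∈ F, ‖p.1‖ * ‖p.2‖) (fun k => norm_nonneg _) hc (fun k => ?_) (fun k => ?_)
  · have h0 : M.preTensorMap N (T ^ 0) t = t :=
      LinearMap.congr_fun (LinearMap.rTensor_id N.carrier M.carrier) t
    simpa only [pow_one, h0] using h
  · have h0 : M.preTensorMap N (T ^ 0) t = t :=
      LinearMap.congr_fun (LinearMap.rTensor_id N.carrier M.carrier) t
    have h2 : T ^ (2 * k) = (T ^ k) ∘ₗ (T ^ k) := by rw [two_mul, pow_add]; rfl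
    simp only [h0, h2]
    exact M.norm_sq_preTensorMap_le N (hsymm k) t
  · simp only [hF, map_sum]
    refine (norm_sum_le _ _).trans ?_
    rw [Finset.sum_mul]
    refine Finset.sum_le_sum fun p _ => ?_
    rw [preTensorMap_preMk]
    refine (M.norm_preMk_le N _ _).trans ?_
    refine (mul_le_mul_of_nonneg_right (hpow k p.1) (norm_nonneg _)).trans_eq ?_
    ring

/-- For an adjointable operator, `‖S ⊗ 1‖ ≤ ‖S‖`. -/
theorem norm_preTensorMap_le {S T : M.carrier →ₗ[ℂ] M.carrier}
    (hadj : ∀ x u, M.inner (S x) u = M.inner x (T u)) {c : ℝ} (hc : 0 ≤ c)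
    (hS : ∀ x, ‖S x‖ ≤ c * ‖x‖) (t : (M.preTensor N).carrier) :
    ‖M.preTensorMap N S t‖ ≤ c * ‖t‖ := by
  have hadj' : ∀ x u, M.inner (T x) u = M.inner x (S u) := fun x u => by
    rw [← M.star_inner, ← hadj, M.star_inner]
  have hT : ∀ x, ‖T x‖ ≤ c * ‖x‖ := fun x => by
    have h1 : ‖T x‖ * ‖T x‖ ≤ c * ‖x‖ * ‖T x‖ := by
      rw [← sq, M.norm_sq_eq, hadj']
      refine (M.norm_inner_le _ _).trans ?_
      have := mul_le_mul_of_nonneg_left (hS (T x)) (norm_nonneg x)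
      linarith
    rcases (norm_nonneg (T x)).eq_or_lt with h | h
    · rw [← h]; positivity
    · exact le_of_mul_le_mul_right h1 h
  have h := M.norm_preTensorMap_le_of_symmetric N (T := T ∘ₗ S) (c := c * c)
    (fun x u => by rw [LinearMap.comp_apply, hadj', hadj]; rfl) (by positivity)
    (fun x => by
      rw [LinearMap.comp_apply]
      refine (hT _).trans ((mul_le_mul_of_nonneg_left (hS x) hc).trans_eq ?_)
      ring) t
  refine le_of_sq_le_sq ?_ (by positivity)
  refine (M.norm_sq_preTensorMap_le N hadj t).trans
    ((mul_le_mul_of_nonneg_left h (norm_nonneg t)).trans_eq ?_)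
  ring

/-- An operator on `M ⊗ N` of the form `S ⊗ 1`, with `S` adjointable, has norm at most `‖S‖`. -/
theorem opNorm_le_of_tmul {S T : M.carrier →L[ℂ] M.carrier}
    (hadj : ∀ x u, M.inner (S x) u = M.inner x (T u))
    {G : (M.tensor N).carrier →L[ℂ] (M.tensor N).carrier}
    (hG : ∀ m n, G (M.tmul N m n) = M.tmul N (S m) n) : ‖G‖ ≤ ‖S‖ := by
  have hGt : ∀ t, G ((M.preTensor N).toCompletion t) =
      (M.preTensor N).toCompletion (M.preTensorMap N S.toLinearMap t) := fun t => by
    obtain ⟨F, rfl⟩ := M.exists_sum_preMk N t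
    change (G.toLinearMap ∘ₗ (M.preTensor N).toCompletion.toLinearMap) _ =
      ((M.preTensor N).toCompletion.toLinearMap ∘ₗ M.preTensorMap N S.toLinearMap) _
    rw [map_sum, map_sum]
    exact Finset.sum_congr rfl fun p _ => hG p.1 p.2
  have hnorm : ∀ t, ‖(M.preTensor N).toCompletion t‖ = ‖t‖ :=
    fun t => UniformSpace.Completion.norm_coe t
  refine G.opNorm_le_bound (norm_nonneg S) fun z => ?_
  refine (M.preTensor N).denseRange_toCompletion.induction_on
    (p := fun z : (M.tensor N).carrier => ‖G z‖ ≤ ‖S‖ * ‖z‖) z ?_ fun t => ?_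
  · exact isClosed_le (by fun_prop) (by fun_prop)
  · refine ((congrArg norm (hGt t)).trans (hnorm _)).trans_le ?_
    refine (M.norm_preTensorMap_le N (T := T.toLinearMap) hadj (norm_nonneg S) S.le_opNorm t).trans
      (congrArg (‖S‖ * ·) (hnorm t)).ge

/-- The map `m ⊗ n ↦ ⟨y, m⟩ · n` on the algebraic tensor product. -/
def preContract (y : M.carrier) : (M.preTensor N).carrier →ₗ[ℂ] N.carrier :=
  TensorProduct.lift (LinearMap.mk₂ ℂ (fun m n => N.left (M.inner y m) n)
    (fun m m' n => by simp) (fun c m n => by simp) (fun m n n' => by simp)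
    (fun c m n => by simp))

theorem preContract_preMk (y m : M.carrier) (n : N.carrier) :
    M.preContract N y (M.preMk N m n) = N.left (M.inner y m) n := rfl

theorem inner_preContract (y : M.carrier) (n : N.carrier) (t : (M.preTensor N).carrier) :
    N.inner n (M.preContract N y t) = (M.preTensor N).inner (M.preMk N y n) t := by
  obtain ⟨F, rfl⟩ := M.exists_sum_preMk N t
  simp only [map_sum, preContract_preMk, inner_preMk]

theorem norm_preContract_le (y : M.carrier) (t : (M.preTensor N).carrier) :
    ‖M.preContract N y t‖ ≤ ‖y‖ * ‖t‖ := by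
  set n := M.preContract N y t with hn
  have h1 : ‖n‖ * ‖n‖ ≤ ‖y‖ * ‖t‖ * ‖n‖ := by
    rw [← sq, N.norm_sq_eq]
    conv_lhs => rw [hn, inner_preContract, ← hn]
    refine ((M.preTensor N).norm_inner_le _ _).trans ?_
    have := mul_le_mul_of_nonneg_right (M.norm_preMk_le N y n) (norm_nonneg t)
    linarith
  rcases (norm_nonneg n).eq_or_lt with h | h
  · rw [← h]; positivity
  · exact le_of_mul_le_mul_right h1 h

/-- The operator `m ⊗ n ↦ ⟨y, m⟩ · n`, the adjoint of `n ↦ y ⊗ n`. -/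
def contract (y : M.carrier) : (M.tensor N).carrier →L[ℂ] N.carrier :=
  (M.preContract N y).extendOfNorm (M.preTensor N).toCompletion.toLinearMap

theorem contract_tmul (y m : M.carrier) (n : N.carrier) :
    M.contract N y (M.tmul N m n) = N.left (M.inner y m) n :=
  LinearMap.extendOfNorm_eq (M.preTensor N).denseRange_toCompletion
    ⟨‖y‖, fun t => (M.norm_preContract_le N y t).trans_eq (congrArg (‖y‖ * ·)
      (UniformSpace.Completion.norm_coe t).symm)⟩ (M.preMk N m n)

theorem clm_ext_tmul {E : Type*} [NormedAddCommGroup E] [NormedSpace ℂ E]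
    {S T : (M.tensor N).carrier →L[ℂ] E} (h : ∀ m n, S (M.tmul N m n) = T (M.tmul N m n)) :
    S = T := M.completion_ext N h

/-- If `B` acts on `N` by compact operators, then `θ_{x,y} ⊗ 1` is compact: for `x = x' · b` it is
`T_{x'} φ_N(b) T_y⋆` with `T_x n = x ⊗ n`, and `T_{x'} θ_{n,n'} T_y⋆ = θ_{x' ⊗ n, y ⊗ n'}`. -/
theorem tmulL_comp_contract_mem_compacts (hN : ∀ b, N.left b ∈ N.compacts) (x y : M.carrier) :
    M.tmulL N x ∘L M.contract N y ∈ (M.tensor N).compacts := by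
  let E := (M.tensor N).carrier
  have hT : ∀ x, ∀ G ∈ N.compacts,
      M.tmulL N x ∘L G ∘L M.contract N y ∈ (M.tensor N).compacts := by
    intro x G hG
    let Φ : (N.carrier →L[ℂ] N.carrier) →L[ℂ] (E →L[ℂ] E) :=
      ContinuousLinearMap.compL ℂ E N.carrier E (M.tmulL N x) ∘L
        (ContinuousLinearMap.compL ℂ E N.carrier N.carrier).flip (M.contract N y)
    refine N.compacts_le (S := (M.tensor N).compacts.comap Φ.toLinearMap)
      ((M.tensor N).isClosed_compacts.preimage Φ.continuous) (fun n n' => ?_) hG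
    have : M.tmulL N x ∘L N.theta n n' ∘L M.contract N y =
        (M.tensor N).theta (M.tmul N x n) (M.tmul N y n') := by
      refine M.clm_ext_tmul N fun m k => ?_
      rw [HilbertModule.theta_apply, inner_tmul, rsmul_tmul, ContinuousLinearMap.comp_apply,
        ContinuousLinearMap.comp_apply, contract_tmul, HilbertModule.theta_apply, tmulL_apply]
    exact (congrArg (· ∈ (M.tensor N).compacts) this).mpr ((M.tensor N).theta_mem_compacts _ _)
  let Ψ : M.carrier →L[ℂ] (E →L[ℂ] E) :=
    (ContinuousLinearMap.compL ℂ E N.carrier E).flip (M.contract N y) ∘L M.tmulL N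
  have hcl : IsClosed {x | Ψ x ∈ (M.tensor N).compacts} :=
    (M.tensor N).isClosed_compacts.preimage Ψ.continuous
  refine hcl.closure_subset_iff.mpr ?_ (M.dense_rsmul x)
  rintro _ ⟨⟨x', b⟩, rfl⟩
  have : Ψ (M.rsmul x' b) = M.tmulL N x' ∘L N.left b ∘L M.contract N y := by
    ext z
    exact M.tmul_rsmul N x' b _
  exact (congrArg (· ∈ (M.tensor N).compacts) this).mpr (hT x' _ (hN b))

/-- If `φ_M(a)` is compact and `B` acts on `N` by compact operators, then `φ_M(a) ⊗ 1` is
compact. -/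
theorem left_tensor_mem_compacts (hN : ∀ b, N.left b ∈ N.compacts) {a : A}
    (ha : M.left a ∈ M.compacts) : (M.tensor N).left a ∈ (M.tensor N).compacts := by
  let E := (M.tensor N).carrier
  -- For `F` in the span of the operators `θ_{x,y}`, `F ⊗ 1` exists and is compact.
  have hspan : ∀ F ∈ Submodule.span ℂ {T | ∃ x y, T = M.theta x y},
      ∃ F' : M.carrier →L[ℂ] M.carrier, (∀ x u, M.inner (F x) u = M.inner x (F' u)) ∧
        ∃ G ∈ (M.tensor N).compacts, ∀ m n, G (M.tmul N m n) = M.tmul N (F m) n := by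
    intro F hF
    induction hF using Submodule.span_induction with
    | mem F hF =>
      obtain ⟨x, y, rfl⟩ := hF
      refine ⟨M.theta y x, fun z u => ?_, _, M.tmulL_comp_contract_mem_compacts N hN x y,
        fun m n => ?_⟩
      · rw [HilbertModule.theta_apply, HilbertModule.theta_apply, M.rsmul_inner, M.inner_rsmul,
          M.star_inner]
      · rw [ContinuousLinearMap.comp_apply, contract_tmul, HilbertModule.theta_apply, tmul_rsmul,
          tmulL_apply]
    | zero => exact ⟨0, by simp, 0, zero_mem _, by simp⟩
    | add F₁ F₂ _ _ h₁ h₂ =>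
      obtain ⟨F₁', h₁, G₁, hG₁, hG₁'⟩ := h₁
      obtain ⟨F₂', h₂, G₂, hG₂, hG₂'⟩ := h₂
      exact ⟨F₁' + F₂', by simp [h₁, h₂], G₁ + G₂, add_mem hG₁ hG₂, by simp [hG₁', hG₂']⟩
    | smul c F _ h =>
      obtain ⟨F', h, G, hG, hG'⟩ := h
      exact ⟨(starRingEnd ℂ) c • F', by simp [h], c • G, Submodule.smul_mem _ c hG, by simp [hG']⟩
  refine (M.tensor N).isClosed_compacts.closure_subset (Metric.mem_closure_iff.mpr fun ε hε => ?_)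
  obtain ⟨F, hF, hFa⟩ := Metric.mem_closure_iff.mp
    (show M.left a ∈ closure (Submodule.span ℂ {T | ∃ x y, T = M.theta x y} : Set _) from ha) ε hε
  obtain ⟨F', hadj, G, hG, hG'⟩ := hspan F hF
  refine ⟨G, hG, ?_⟩
  rw [dist_eq_norm] at hFa ⊢
  refine (M.opNorm_le_of_tmul N (S := M.left a - F) (T := M.left (star a) - F') ?_ ?_).trans_lt hFa
  · intro x u
    simp [M.inner_left, hadj]
  · intro m n
    simp [hG', left_tmul]

end Tensor

/-- The tensor product of regular correspondences is regular. The left action is injective since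
`⟨m ⊗ n, a · (m' ⊗ n')⟩ = ⟨n, ⟨m, a · m'⟩ · n'⟩`. -/
theorem IsRegular.tensor {M : CStarCorrespondence A B} {N : CStarCorrespondence B C}
    (hM : M.IsRegular) (hN : N.IsRegular) : (M.tensor N).IsRegular := by
  refine ⟨(injective_iff_map_eq_zero _).mpr fun a ha => ?_,
    fun a => M.left_tensor_mem_compacts N hN.2 (hM.2 a)⟩
  refine (injective_iff_map_eq_zero _).mp hM.1 a ?_
  ext m'
  refine M.ext_inner fun m => ?_
  rw [zero_apply, map_zero]
  refine (injective_iff_map_eq_zero _).mp hN.1 _ ?_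
  ext n'
  refine N.ext_inner fun n => ?_
  rw [zero_apply, map_zero, ← inner_tmul, ← left_tmul, ha, zero_apply, map_zero]

theorem isRegular_identity (A : Type u) [NonUnitalCStarAlgebra A] : (identity A).IsRegular := by
  refine ⟨(injective_iff_map_eq_zero _).mpr fun a ha => ?_, fun a => ?_⟩
  · have h : a * star a = 0 := congrArg (fun T : A →L[ℂ] A => T (star a)) ha
    exact CStarRing.mul_star_self_eq_zero_iff a |>.mp h
  · -- `φ(a)` is the limit of `φ(a e⋆) = θ_{a,e}` along an approximate unit.
    obtain ⟨l, hl, -, h⟩ := exists_approximateUnit A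
    have hlim : Filter.Tendsto (fun e => a * star e) l (nhds a) := by
      have h1 := (continuous_star.tendsto _).comp (h (star a))
      rw [star_star] at h1
      exact h1.congr fun e => by simp
    refine (identity A).isClosed_compacts.mem_of_tendsto
      (((identity A).leftL.continuous.tendsto a).comp hlim) (Filter.Eventually.of_forall fun e => ?_)
    have : (identity A).left (a * star e) = (identity A).theta a e := by
      ext z
      exact mul_assoc a (star e) z
    exact (congrArg (· ∈ (identity A).compacts) this).mpr ((identity A).theta_mem_compacts a e)

end CStarCorrespondence

end

noncomputable section

/-! ### The category of C⋆-correspondences -/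

namespace ECCor

open CStarCorrespondence

namespace Pair

/-- The tensor product of two pairs which define morphisms is regular and satisfies
`J_X · (M ⊗ N) ⊆ (M ⊗ N) · J_Z`. -/
theorem IsMorphism.comp {X Y Z : ECCor.{u}} {p : Pair X Y} {q : Pair Y Z} (hp : p.IsMorphism)
    (hq : q.IsMorphism) : (p.comp q).IsMorphism := by
  refine ⟨hp.1.tensor hq.1, ?_⟩
  rintro _ ⟨a, ha, t, rfl⟩
  refine exists_rsmul_katsuraIdeal_iff.mpr fun (w : (p.M.tensor q.M).carrier) => ?_
  -- The vectors `t` with `⟨w, a · t⟩ ∈ J_Z` form a closed subspace, so that elementary tensors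
  -- suffice: `a · m = m' · b` with `b ∈ J_Y`, and `b · n = n' · c` with `c ∈ J_Z`.
  let E := p.M.tensor q.M
  let L : E.carrier →L[ℂ] Z.algebra := E.innerL w ∘L E.left a
  have hle : (⊤ : Submodule ℂ E.carrier) ≤ Z.corr.katsuraSubmodule.comap L.toLinearMap := by
    rw [← p.M.topologicalClosure_span_tmul q.M]
    refine Submodule.topologicalClosure_minimal _ (Submodule.span_le.mpr ?_)
      (Z.corr.isClosed_katsuraIdeal.preimage L.continuous)
    rintro _ ⟨⟨m, n⟩, rfl⟩
    obtain ⟨m', b, hb, hm⟩ := hp.2 ⟨a, ha, m, rfl⟩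
    obtain ⟨n', c, hc, hn⟩ := hq.2 ⟨b, hb, n, rfl⟩
    have h : E.left a (p.M.tmul q.M m n) = E.rsmul (p.M.tmul q.M m' n') c := by
      rw [left_tmul, rsmul_tmul, ← hm, tmul_rsmul, hn]
    change E.inner w (E.left a (p.M.tmul q.M m n)) ∈ Z.corr.katsuraIdeal
    rw [h, E.inner_rsmul]
    exact Z.corr.mul_mem_katsuraIdeal_left hc _
  exact hle (x := t) Submodule.mem_top

theorem isMorphism_id (X : ECCor.{u}) : (Pair.id X).IsMorphism := by
  refine ⟨isRegular_identity _, ?_⟩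
  rintro _ ⟨a, ha, m, rfl⟩
  refine exists_rsmul_katsuraIdeal_iff.mpr fun w => ?_
  exact X.corr.mul_mem_katsuraIdeal_left (X.corr.mul_mem_katsuraIdeal_right ha m) (star w)

open CategoryTheory Bicategory

/-- The C⋆-algebra of an object, as an object of the bicategory. -/
abbrev obj (X : ECCor.{u}) : BundledCStarAlgebra.{u} := ⟨X.algebra⟩

/-- The correspondence of an object, as an endomorphism in the bicategory. -/
abbrev endo (X : ECCor.{u}) : obj X ⟶ obj X := X.corr

/-- The correspondence of a pair, as a 1-cell. -/
abbrev cell {X Y : ECCor.{u}} (p : Pair X Y) : obj X ⟶ obj Y := p.M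

/-- The isomorphism of a pair, as a 2-cell. -/
abbrev square {X Y : ECCor.{u}} (p : Pair X Y) : endo X ≫ cell p ⟶ cell p ≫ endo Y := p.U

/-- An isomorphism of pairs is a 2-cell which slides along the squares. -/
theorem isomorphic_of_square {X Y : ECCor.{u}} {p q : Pair X Y} (ξ : cell p ⟶ cell q)
    (h : endo X ◁ ξ ≫ square q = square p ≫ ξ ▷ endo Y) : p.Isomorphic q :=
  ⟨ξ, fun t => congrArg (fun e : CStarCorrespondence.Iso _ _ => e t) h⟩

theorem square_of_isomorphic {X Y : ECCor.{u}} {p q : Pair X Y} (h : p.Isomorphic q) :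
    ∃ ξ : cell p ⟶ cell q, endo X ◁ ξ ≫ square q = square p ≫ ξ ▷ endo Y :=
  h.imp fun _ h => CStarCorrespondence.Iso.ext h

theorem Isomorphic.comp {X Y Z : ECCor.{u}} {p p' : Pair X Y} {q q' : Pair Y Z}
    (hp : p.Isomorphic p') (hq : q.Isomorphic q') : (p.comp q).Isomorphic (p'.comp q') := by
  obtain ⟨ξ, hξ⟩ := square_of_isomorphic hp
  obtain ⟨η, hη⟩ := square_of_isomorphic hq
  exact isomorphic_of_square (p := p.comp q) (q := p'.comp q') (ξ ▷ cell q ≫ cell p' ◁ η)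
    (paste_congr hξ hη)

theorem id_comp_isomorphic {X Y : ECCor.{u}} (p : Pair X Y) :
    ((Pair.id X).comp p).Isomorphic p :=
  isomorphic_of_square (p := (Pair.id X).comp p) (q := p) (λ_ (cell p)).hom
    (unit_paste (square p))

theorem comp_id_isomorphic {X Y : ECCor.{u}} (p : Pair X Y) :
    (p.comp (Pair.id Y)).Isomorphic p :=
  isomorphic_of_square (p := p.comp (Pair.id Y)) (q := p) (ρ_ (cell p)).hom
    (paste_unit (square p))

theorem comp_assoc_isomorphic {X Y Z W : ECCor.{u}} (p : Pair X Y) (q : Pair Y Z) (r : Pair Z W) :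
    ((p.comp q).comp r).Isomorphic (p.comp (q.comp r)) :=
  isomorphic_of_square (p := (p.comp q).comp r) (q := p.comp (q.comp r))
    (α_ (cell p) (cell q) (cell r)).hom (paste_assoc (square p) (square q) (square r))

end Pair

/-- The composition of isomorphism classes. -/
def Mor.comp {X Y Z : ECCor.{u}} : Mor X Y → Mor Y Z → Mor X Z :=
  Quotient.map₂ (fun p q => ⟨p.1.comp q.1, p.2.comp q.2⟩) fun _ _ hp _ _ hq => hp.comp hq

/-- The category of C⋆-correspondences. -/
abbrev category : CategoryTheory.Category.{u + 1, u + 1} ECCor.{u} where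
  Hom := Mor
  id X := cls (Pair.id X) (Pair.isMorphism_id X)
  comp := Mor.comp
  id_comp f := by
    induction f using Quotient.inductionOn with
    | h p => exact Quotient.sound (Pair.id_comp_isomorphic p.1)
  comp_id f := by
    induction f using Quotient.inductionOn with
    | h p => exact Quotient.sound (Pair.comp_id_isomorphic p.1)
  assoc f g h := by
    induction f, g, h using Quotient.inductionOn₃ with
    | h p q r => exact Quotient.sound (Pair.comp_assoc_isomorphic p.1 q.1 r.1)

end ECCor

end

theorem mainTheorem7 :
    ∃ (hcomp : ∀ {X Y Z : ECCor.{u}} (p : ECCor.Pair X Y) (q : ECCor.Pair Y Z),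
          p.IsMorphism → q.IsMorphism → (p.comp q).IsMorphism)
      (hid : ∀ X : ECCor.{u}, (ECCor.Pair.id X).IsMorphism)
      (comp : ∀ {X Y Z : ECCor.{u}}, ECCor.Mor X Y → ECCor.Mor Y Z → ECCor.Mor X Z)
      (cat : CategoryTheory.Category.{u + 1, u + 1} ECCor.{u}),
      cat.toCategoryStruct =
          { Hom := ECCor.Mor
            id := fun X => ECCor.cls (ECCor.Pair.id X) (hid X)
            comp := comp } ∧
        ∀ {X Y Z : ECCor.{u}} (p : ECCor.Pair X Y) (q : ECCor.Pair Y Z)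
          (hp : p.IsMorphism) (hq : q.IsMorphism),
          comp (ECCor.cls p hp) (ECCor.cls q hq) =
            ECCor.cls (p.comp q) (hcomp p q hp hq) :=
  ⟨fun _ _ hp hq => hp.comp hq, ECCor.Pair.isMorphism_id, ECCor.Mor.comp, ECCor.category, rfl,
    fun _ _ _ _ => rfl⟩
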